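/- A complete deterministic automaton consists of a finite set of states and finitely many letters, each acting as a map from the set of states to itself. Its reset threshold is the length of a shortest word that maps all states to one and the same state; the automaton is synchronizing if such a word exists. Its square graph is the directed graph whose vertices are the unordered pairs $\{p,q\}$ of states, the singletons $\{q,q\}$ included, with an edge from $\{p,q\}$ to $\{pa,qa\}$ for every letter $a$, where $qa$ is the image of $q$ under $a$. The diameter of the square graph is the maximum, over all non-singleton vertices $u$, of the length of a shortest directed path from $u$ to a singleton. For $n\ge 1$ let $Q_1$ and $Q_2$ be the following symmetric (that is, involutive) permutations of $\{1,\dots,n\}$: $Q_1$ exchanges $2\leftrightarrow 3$, $4\leftrightarrow 5$, and so on, and fixes $1$, and also $n$ if $n$ is even; $Q_2$ exchanges $1\leftrightarrow 2$, $3\leftrightarrow 4$, and so on, and fixes $n$ if $n$ is odd. For $i\ne j$ let $\mathcal A_{ij}$ be the automaton with states $1,\dots,n$ and three letters: $Q_1$, $Q_2$, and the map that sends $i$ to $j$ and fixes every other state. Put $\mathcal E_n=\mathcal A_{1,n-2}$ for $n=4k$, $k\ge 2$; $\mathcal E'_n=\mathcal A_{1,n-4}$ for $n=4k+2$, $k\ge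 2$; $\mathcal O_n=\mathcal A_{\frac{n-1}{2},\frac{n+1}{2}}$ for $n=4k+1$, $k\ge 1$; $\mathcal O'_n=\mathcal A_{\frac{n-1}{2},\frac{n+1}{2}}$ for $n=4k+3$, $k\ge 1$. **Theorem.** The square graphs of $\mathcal E_n$, $\mathcal E'_n$, $\mathcal O_n$ and $\mathcal O'_n$ have diameter $(n^2+2n-4)/4$, $(n^2+2n-12)/4$, $(n^2+3n-8)/4$ and $(n^2+3n-6)/4$, respectively. All these automata are synchronizing, and their reset thresholds are at least $n^2/4$; in particular, the reset thresholds are $\Omega(n^2/4)$. -/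

import Mathlib

namespace SlowSync

/-! A complete deterministic automaton with states `Q` and letters `A` is given by its
transition function `δ : Q → A → Q`. -/

/-- The action of a word on a state. -/
def run {Q A : Type*} (δ : Q → A → Q) (q : Q) (w : List A) : Q := w.foldl δ q

/-- `w` is a synchronizing word: it brings all the states to one and the same state. -/
def IsSyncWord {Q A : Type*} (δ : Q → A → Q) (w : List A) : Prop :=
  ∃ v : Q, ∀ q : Q, run δ q w = v

/-- The automaton is synchronizing. -/
def IsSynchronizing {Q A : Type*} (δ : Q → A → Q) : Prop :=
  ∃ w : List A, IsSyncWord δ w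

/-- The length of a shortest synchronizing word (`⊤` if there is none). -/
noncomputable def resetThreshold {Q A : Type*} (δ : Q → A → Q) : ℕ∞ :=
  ⨅ (w : List A) (_ : IsSyncWord δ w), (w.length : ℕ∞)

/-- The edges of the square graph. Its vertices are the unordered pairs of states, the pairs
`s(q, q)` included; a letter `a` leads from `s(p, q)` to `s(δ p a, δ q a)`. -/
def SquareEdge {Q A : Type*} (δ : Q → A → Q) (u v : Sym2 Q) : Prop :=
  ∃ a : A, u.map (fun q => δ q a) = v

/-- There is a directed path of length `l` from `u` to `v` in the square graph. -/
def SquarePath {Q A : Type*} (δ : Q → A → Q) : ℕ → Sym2 Q → Sym2 Q → Prop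
  | 0, u, v => u = v
  | l + 1, u, v => ∃ w : Sym2 Q, SquareEdge δ u w ∧ SquarePath δ l w v

/-- The length of a shortest directed path from `u` to `v` in the square graph (`⊤` if there
is none). -/
noncomputable def squareDist {Q A : Type*} (δ : Q → A → Q) (u v : Sym2 Q) : ℕ∞ :=
  ⨅ (l : ℕ) (_ : SquarePath δ l u v), (l : ℕ∞)

/-- The diameter of the square graph: the largest distance from a non-singleton vertex to the
singletons, that is, to a nearest singleton. -/
noncomputable def squareDiam {Q A : Type*} (δ : Q → A → Q) : ℕ∞ :=
  ⨆ (u : Sym2 Q) (_ : ¬ u.IsDiag), ⨅ (s : Sym2 Q) (_ : s.IsDiag), squareDist δ u s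

/-- The states `1, …, n`. -/
abbrev State (n : ℕ) : Type := ↥(Finset.Icc 1 n)

/-- The map that exchanges `2 ↔ 3`, `4 ↔ 5`, … and fixes `1`, and also `n` if `n` is even. -/
def fun1 (n : ℕ) (x : State n) : State n :=
  ⟨if x.1 = 1 then 1 else if x.1 % 2 = 0 then (if x.1 = n then n else x.1 + 1) else x.1 - 1, by
    have h := Finset.mem_Icc.1 x.2
    rw [Finset.mem_Icc]
    split_ifs <;> omega⟩

/-- The map that exchanges `1 ↔ 2`, `3 ↔ 4`, … and fixes `n` if `n` is odd. -/
def fun2 (n : ℕ) (x : State n) : State n :=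
  ⟨if x.1 % 2 = 0 then x.1 - 1 else (if x.1 = n then n else x.1 + 1), by
    have h := Finset.mem_Icc.1 x.2
    rw [Finset.mem_Icc]
    split_ifs <;> omega⟩

theorem fun1_involutive (n : ℕ) : Function.Involutive (fun1 n) := by
  intro x
  have h := Finset.mem_Icc.1 x.2
  apply Subtype.ext
  simp only [fun1]
  split_ifs <;> omega

theorem fun2_involutive (n : ℕ) : Function.Involutive (fun2 n) := by
  intro x
  have h := Finset.mem_Icc.1 x.2
  apply Subtype.ext
  simp only [fun2]
  split_ifs <;> omega

/-- The symmetric permutation `Q₁`. -/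
def perm1 (n : ℕ) : Equiv.Perm (State n) := (fun1_involutive n).toPerm

/-- The symmetric permutation `Q₂`. -/
def perm2 (n : ℕ) : Equiv.Perm (State n) := (fun2_involutive n).toPerm

/-- The three letters of the automata below. -/
inductive Letter
  | pert
  | one
  | two

/-- The automaton `𝒜ᵢⱼ` on the states `1, …, n`: the letter `pert` moves `i` to `j` and fixes
every other state, the letters `one` and `two` act as the permutations `Q₁` and `Q₂`. -/
def autA (n : ℕ) (i j : State n) : State n → Letter → State n
  | x, Letter.pert => if x = i then j else x
  | x, Letter.one => perm1 n x
  | x, Letter.two => perm2 n x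

/-- `ℰ_n = 𝒜_{1, n-2}`, for `n = 4k` and `k ≥ 2`. -/
def autE (n : ℕ) (h : 8 ≤ n ∧ n % 4 = 0) : State n → Letter → State n :=
  autA n ⟨1, Finset.mem_Icc.2 (by omega)⟩ ⟨n - 2, Finset.mem_Icc.2 (by omega)⟩

/-- `ℰ'_n = 𝒜_{1, n-4}`, for `n = 4k + 2` and `k ≥ 2`. -/
def autE' (n : ℕ) (h : 10 ≤ n ∧ n % 4 = 2) : State n → Letter → State n :=
  autA n ⟨1, Finset.mem_Icc.2 (by omega)⟩ ⟨n - 4, Finset.mem_Icc.2 (by omega)⟩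

/-- `𝒪_n = 𝒜_{(n-1)/2, (n+1)/2}`, for `n = 4k + 1` and `k ≥ 1`. -/
def autO (n : ℕ) (h : 5 ≤ n ∧ n % 4 = 1) : State n → Letter → State n :=
  autA n ⟨(n - 1) / 2, Finset.mem_Icc.2 (by omega)⟩ ⟨(n + 1) / 2, Finset.mem_Icc.2 (by omega)⟩

/-- `𝒪'_n = 𝒜_{(n-1)/2, (n+1)/2}`, for `n = 4k + 3` and `k ≥ 1`. -/
def autO' (n : ℕ) (h : 7 ≤ n ∧ n % 4 = 3) : State n → Letter → State n :=
  autA n ⟨(n - 1) / 2, Finset.mem_Icc.2 (by omega)⟩ ⟨(n + 1) / 2, Finset.mem_Icc.2 (by omega)⟩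

/-- The diameter of the square graph is finite and equal to the rational number `d`. -/
def HasSquareDiam {Q A : Type*} (δ : Q → A → Q) (d : ℚ) : Prop :=
  ∃ m : ℕ, squareDiam δ = (m : ℕ∞) ∧ (m : ℚ) = d

/-- The automaton is synchronizing, and its reset threshold is at least `b`. -/
def SyncWithThresholdGE {Q A : Type*} (δ : Q → A → Q) (b : ℚ) : Prop :=
  IsSynchronizing δ ∧ ∃ r : ℕ, resetThreshold δ = (r : ℕ∞) ∧ b ≤ (r : ℚ)

end SlowSync

/-! The proof exhibits the distance to the singletons as an explicit potential `F` on pairs. If `F`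
vanishes on singletons, drops by at most one along every edge, and drops along some edge at every
non-singleton, then `F` is that distance (`iInf_squareDist_eq`). The maximum of `F` is therefore the
diameter. Since every pair can be merged, the automaton is synchronizing. A synchronizing word
merges every pair, in particular a farthest one, so the reset threshold is at least the diameter.

To find `F`, arrange the states as an `n`-gon in the cyclic order …, 5, 3, 1, 2, 4, 6, …. The two
permutations act on it as reflections, so the cyclic distance of a pair is invariant; `orbitIndex`
is twice that distance. On each orbit the two letters form a path with coordinate `orbitPos`. It has
`n` vertices, or `n / 2` when the index is `n`.

Only the third letter can change the orbit, and only on a pair containing `i`. A shortest merging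
path thus runs along an orbit to an exit pair containing `i`, jumps to another orbit, and repeats.
This suggests `F = C d + |orbitPos - X d|` on the orbit `d`, with exit position `X d` and exit cost
`C d`. The steps inside an orbit are automatic; what remains is to compare `{i, q}` with `{j, q}`
for each `q` (`autA_squareDiam_and_sync`).

In every family the exits string the orbits into one chain, starting with the orbit of `{i, j}`.
Each jump lands far from the next exit, so about `n / 2` orbits cost about `n / 2` each. For odd `n
= 2h + 1` the chain is 2h, 2, 2h-2, 4, …. For `n = 4k` it is 4k-2, 4, 4k-6, 8, …, 2, 4k. For `n = 4k
+ 2` it first alternates 4k-2, 8, 4k-10, 16, …, then turns, and alternates between indices that are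
4 mod 8 and the remaining class, up to 4k+2. The maximum of `F` is attained at an end of the last
orbit. -/

namespace SlowSync

/-! ### Potentials on the square graph, diameter and reset threshold -/

section Potential

variable {Q A : Type*} {δ : Q → A → Q} {F : Sym2 Q → ℕ}

theorem le_length_of_squarePath (hdiag : ∀ u : Sym2 Q, u.IsDiag → F u = 0)
    (hstep : ∀ u a, F u ≤ F (u.map fun q => δ q a) + 1) :
    ∀ (l : ℕ) (u v : Sym2 Q), v.IsDiag → SquarePath δ l u v → F u ≤ l
  | 0, u, v, hv, h => by
    obtain rfl : u = v := h
    exact (hdiag u hv).le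
  | l + 1, u, v, hv, ⟨w, ⟨a, ha⟩, hw⟩ => by
    have h1 := le_length_of_squarePath hdiag hstep l w v hv hw
    have h2 := hstep u a
    rw [ha] at h2
    omega

/-- Following a decreasing edge repeatedly must end at a singleton within `F u` steps, since `F`
takes natural values. -/
theorem exists_squarePath_le
    (hdesc : ∀ u : Sym2 Q, ¬ u.IsDiag → ∃ a, F (u.map fun q => δ q a) < F u) (m : ℕ) :
    ∀ u : Sym2 Q, F u ≤ m → ∃ l v, l ≤ m ∧ v.IsDiag ∧ SquarePath δ l u v := by
  induction m with
  | zero =>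
    intro u hu
    by_cases hd : u.IsDiag
    · exact ⟨0, u, le_rfl, hd, rfl⟩
    · obtain ⟨a, ha⟩ := hdesc u hd
      omega
  | succ m ih =>
    intro u hu
    by_cases hd : u.IsDiag
    · exact ⟨0, u, by omega, hd, rfl⟩
    · obtain ⟨a, ha⟩ := hdesc u hd
      obtain ⟨l, v, hl, hv, hp⟩ := ih (u.map fun q => δ q a) (by omega)
      exact ⟨l + 1, v, by omega, hv, _, ⟨a, rfl⟩, hp⟩

theorem iInf_squareDist_eq (hdiag : ∀ u : Sym2 Q, u.IsDiag → F u = 0)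
    (hstep : ∀ u a, F u ≤ F (u.map fun q => δ q a) + 1)
    (hdesc : ∀ u : Sym2 Q, ¬ u.IsDiag → ∃ a, F (u.map fun q => δ q a) < F u) (u : Sym2 Q) :
    ⨅ (s : Sym2 Q) (_ : s.IsDiag), squareDist δ u s = (F u : ℕ∞) := by
  apply le_antisymm
  · obtain ⟨l, v, hl, hv, hp⟩ := exists_squarePath_le hdesc (F u) u le_rfl
    refine (iInf₂_le v hv).trans ((iInf₂_le l hp).trans ?_)
    exact_mod_cast hl
  · refine le_iInf₂ fun s hs => le_iInf₂ fun l hl => ?_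
    exact_mod_cast le_length_of_squarePath hdiag hstep l u s hs hl

theorem squareDiam_eq {M : ℕ} (hdiag : ∀ u : Sym2 Q, u.IsDiag → F u = 0)
    (hstep : ∀ u a, F u ≤ F (u.map fun q => δ q a) + 1)
    (hdesc : ∀ u : Sym2 Q, ¬ u.IsDiag → ∃ a, F (u.map fun q => δ q a) < F u)
    (hle : ∀ u, F u ≤ M) (hM : ∃ u : Sym2 Q, ¬ u.IsDiag ∧ F u = M) :
    squareDiam δ = (M : ℕ∞) := by
  unfold squareDiam
  simp_rw [iInf_squareDist_eq hdiag hstep hdesc]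
  apply le_antisymm
  · exact iSup₂_le fun u _ => by exact_mod_cast hle u
  · obtain ⟨u, hu, rfl⟩ := hM
    exact le_iSup₂ (f := fun (u : Sym2 Q) (_ : ¬ u.IsDiag) => (F u : ℕ∞)) u hu

theorem le_length_of_isSyncWord (hdiag : ∀ u : Sym2 Q, u.IsDiag → F u = 0)
    (hstep : ∀ u a, F u ≤ F (u.map fun q => δ q a) + 1) (w : List A) :
    ∀ p q : Q, run δ p w = run δ q w → F s(p, q) ≤ w.length := by
  induction w with
  | nil =>
    intro p q h
    exact (hdiag _ (Sym2.mk_isDiag_iff.2 h)).le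
  | cons a w ih =>
    intro p q h
    have h1 := ih (δ p a) (δ q a) h
    have h2 := hstep s(p, q) a
    rw [Sym2.map_mk] at h2
    simp only [List.length_cons]
    exact h2.trans (by simpa using h1)

theorem run_append (p : Q) (v w : List A) : run δ p (v ++ w) = run δ (run δ p v) w :=
  List.foldl_append

theorem exists_merging_word
    (hdesc : ∀ u : Sym2 Q, ¬ u.IsDiag → ∃ a, F (u.map fun q => δ q a) < F u) (m : ℕ) :
    ∀ p q : Q, F s(p, q) ≤ m → ∃ w, run δ p w = run δ q w := by
  induction m with
  | zero =>
    intro p q h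
    by_cases hd : p = q
    · exact ⟨[], by rw [hd]⟩
    · obtain ⟨a, ha⟩ := hdesc s(p, q) (by simpa using hd)
      omega
  | succ m ih =>
    intro p q h
    by_cases hd : p = q
    · exact ⟨[], by rw [hd]⟩
    · obtain ⟨a, ha⟩ := hdesc s(p, q) (by simpa using hd)
      rw [Sym2.map_mk] at ha
      obtain ⟨w, hw⟩ := ih (δ p a) (δ q a) (Nat.lt_succ_iff.1 (ha.trans_le h))
      exact ⟨a :: w, hw⟩

/-- If the image of the current word has two distinct states, appending a word that merges them
strictly shrinks the image; induction on its size. -/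
theorem isSynchronizing_of_merging [Finite Q] [Nonempty Q]
    (h : ∀ p q : Q, ∃ w, run δ p w = run δ q w) : IsSynchronizing δ := by
  classical
  have := Fintype.ofFinite Q
  have key : ∀ (m : ℕ) (v : List A), (Finset.univ.image fun q => run δ q v).card ≤ m + 1 →
      IsSynchronizing δ := by
    intro m
    induction m with
    | zero =>
      intro v hv
      obtain ⟨q₀⟩ := ‹Nonempty Q›
      refine ⟨v, run δ q₀ v, fun q => ?_⟩
      exact Finset.card_le_one.1 hv _ (Finset.mem_image_of_mem _ (Finset.mem_univ q)) _
        (Finset.mem_image_of_mem _ (Finset.mem_univ q₀))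
    | succ m ih =>
      intro v hv
      by_cases hc : ∀ p q, run δ p v = run δ q v
      · obtain ⟨q₀⟩ := ‹Nonempty Q›
        exact ⟨v, run δ q₀ v, fun q => hc q q₀⟩
      · push Not at hc
        obtain ⟨p, q, hpq⟩ := hc
        obtain ⟨w, hw⟩ := h (run δ p v) (run δ q v)
        apply ih (v ++ w)
        have himg : (Finset.univ.image fun q => run δ q (v ++ w)) =
            (Finset.univ.image fun q => run δ q v).image fun q => run δ q w := by
          rw [Finset.image_image]
          congr 1
          funext x
          exact run_append x v w
        rw [himg]
        have hlt : ((Finset.univ.image fun q => run δ q v).image fun q => run δ q w).card <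
            (Finset.univ.image fun q => run δ q v).card := by
          refine lt_of_le_of_ne Finset.card_image_le fun he => hpq ?_
          exact Finset.card_image_iff.1 he (by simp) (by simp) hw
        omega
  exact key (Fintype.card Q) [] (Finset.card_le_univ _ |>.trans (Nat.le_succ _))

theorem syncWithThresholdGE_of_potential [Finite Q] [Nonempty Q] {b : ℚ}
    (hdiag : ∀ u : Sym2 Q, u.IsDiag → F u = 0)
    (hstep : ∀ u a, F u ≤ F (u.map fun q => δ q a) + 1)
    (hdesc : ∀ u : Sym2 Q, ¬ u.IsDiag → ∃ a, F (u.map fun q => δ q a) < F u)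
    (hb : ∃ u : Sym2 Q, b ≤ F u) :
    SyncWithThresholdGE δ b := by
  have hs : IsSynchronizing δ :=
    isSynchronizing_of_merging fun p q => exists_merging_word hdesc _ p q le_rfl
  refine ⟨hs, ?_⟩
  obtain ⟨u, hu⟩ := hb
  have hlow : (F u : ℕ∞) ≤ resetThreshold δ := by
    refine le_iInf₂ fun w hw => ?_
    obtain ⟨v, hv⟩ := hw
    induction u with
    | _ p q =>
      exact_mod_cast le_length_of_isSyncWord hdiag hstep w p q ((hv p).trans (hv q).symm)
  have hfin : resetThreshold δ ≠ ⊤ := by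
    obtain ⟨w, hw⟩ := hs
    exact ne_top_of_le_ne_top (ENat.natCast_ne_top w.length) (iInf₂_le w hw)
  obtain ⟨r, hr⟩ := ENat.ne_top_iff_exists.1 hfin
  refine ⟨r, hr.symm, hu.trans ?_⟩
  rw [← hr] at hlow
  exact_mod_cast hlow

end Potential

/-! ### Orbits of pairs under the two reflections -/

/-- The letter `one` on natural numbers. -/
def flip1 (n x : ℕ) : ℕ :=
  if x = 1 then 1 else if x % 2 = 0 then (if x = n then n else x + 1) else x - 1

/-- The letter `two` on natural numbers. -/
def flip2 (n x : ℕ) : ℕ :=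
  if x % 2 = 0 then x - 1 else (if x = n then n else x + 1)

/-- The orbit of the pair `{p, q}` under the dihedral group generated by the letters `one` and
`two` is determined by this even number. -/
def orbitIndex (n p q : ℕ) : ℕ :=
  if (p + q) % 2 = 0 then (p - q) + (q - p) else if p + q ≤ n + 1 then p + q - 1
  else 2 * n + 1 - (p + q)

/-- The position of the pair `{p, q}` on its orbit, which the letters `one` and `two` turn into
a path. -/
def orbitPos (n p q : ℕ) : ℕ :=
  if (p + q) % 2 = 0 then (p + q) / 2 - 1 else if p + q ≤ n + 1 then ((p - q) + (q - p) - 1) / 2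
  else n - 1 - ((p - q) + (q - p) - 1) / 2

theorem orbitIndex_comm (n p q : ℕ) : orbitIndex n p q = orbitIndex n q p := by
  simp only [orbitIndex, Nat.add_comm p q, Nat.add_comm (p - q) (q - p)]

theorem orbitPos_comm (n p q : ℕ) : orbitPos n p q = orbitPos n q p := by
  simp only [orbitPos, Nat.add_comm p q, Nat.add_comm (p - q) (q - p)]

/-- The three stretches of the orbit path of index `d`: pairs of sum `d + 1` with growing
difference, then pairs of difference `d` with growing sum, then pairs of sum `2n + 1 - d` with
shrinking difference. Written without division or truncated subtraction of `p` and `q`, they are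
usable by `omega`. -/
theorem orbit_cases {n p q : ℕ} (hp : 1 ≤ p) (hpn : p ≤ n) (hq : 1 ≤ q) (hqn : q ≤ n)
    (_ : p ≠ q) :
    (∃ m, p + q = 2 * m ∧ orbitIndex n p q = (p - q) + (q - p) ∧ orbitPos n p q + 1 = m) ∨
    (∃ m, (q = p + 2 * m + 1 ∨ p = q + 2 * m + 1) ∧ p + q ≤ n + 1 ∧
      orbitIndex n p q + 1 = p + q ∧ orbitPos n p q = m) ∨
    (∃ m, (q = p + 2 * m + 1 ∨ p = q + 2 * m + 1) ∧ n + 1 < p + q ∧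
      orbitIndex n p q + (p + q) = 2 * n + 1 ∧ orbitPos n p q + m + 1 = n) := by
  by_cases h1 : (p + q) % 2 = 0
  · refine Or.inl ⟨(p + q) / 2, by omega, ?_, ?_⟩
    · simp only [orbitIndex, if_pos h1]
    · simp only [orbitPos, if_pos h1]
      omega
  · by_cases h2 : p + q ≤ n + 1
    · refine Or.inr (Or.inl ⟨((p - q) + (q - p) - 1) / 2, by omega, h2, ?_, ?_⟩)
      · simp only [orbitIndex, if_neg h1, if_pos h2]
        omega
      · simp only [orbitPos, if_neg h1, if_pos h2]
    · refine Or.inr (Or.inr ⟨((p - q) + (q - p) - 1) / 2, by omega, by omega, ?_, ?_⟩)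
      · simp only [orbitIndex, if_neg h1, if_neg h2]
        omega
      · simp only [orbitPos, if_neg h1, if_neg h2]
        omega

theorem flip1_cases {n x : ℕ} (hx : 1 ≤ x) (hxn : x ≤ n) :
    (x = 1 ∧ flip1 n x = 1) ∨ (∃ m, x = 2 * m ∧ x = n ∧ flip1 n x = x) ∨
    (∃ m, x = 2 * m ∧ x < n ∧ flip1 n x = x + 1) ∨
    (∃ m, x = 2 * m + 1 ∧ 1 ≤ m ∧ flip1 n x = 2 * m) := by
  unfold flip1
  split_ifs with h1 h2 h3
  · exact Or.inl ⟨h1, rfl⟩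
  · exact Or.inr (Or.inl ⟨x / 2, by omega, h3, h3.symm⟩)
  · exact Or.inr (Or.inr (Or.inl ⟨x / 2, by omega, by omega, rfl⟩))
  · exact Or.inr (Or.inr (Or.inr ⟨x / 2, by omega, by omega, by omega⟩))

theorem flip2_cases {n x : ℕ} (hx : 1 ≤ x) (hxn : x ≤ n) :
    (∃ m, x = 2 * m ∧ flip2 n x + 1 = x) ∨ (∃ m, x = 2 * m + 1 ∧ x = n ∧ flip2 n x = x) ∨
    (∃ m, x = 2 * m + 1 ∧ x < n ∧ flip2 n x = x + 1) := by
  unfold flip2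
  split_ifs with h1 h2
  · exact Or.inl ⟨x / 2, by omega, by omega⟩
  · exact Or.inr (Or.inl ⟨x / 2, by omega, h2, h2.symm⟩)
  · exact Or.inr (Or.inr ⟨x / 2, by omega, by omega, rfl⟩)

theorem flip1_mem {n x : ℕ} (hx : 1 ≤ x) (hxn : x ≤ n) : 1 ≤ flip1 n x ∧ flip1 n x ≤ n := by
  rcases flip1_cases hx hxn with h | ⟨m, h⟩ | ⟨m, h⟩ | ⟨m, h⟩ <;> omega

theorem flip2_mem {n x : ℕ} (hx : 1 ≤ x) (hxn : x ≤ n) : 1 ≤ flip2 n x ∧ flip2 n x ≤ n := by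
  rcases flip2_cases hx hxn with ⟨m, h⟩ | ⟨m, h⟩ | ⟨m, h⟩ <;> omega

theorem flip1_ne {n p q : ℕ} (hp : 1 ≤ p) (hpn : p ≤ n) (hq : 1 ≤ q) (hqn : q ≤ n)
    (hpq : p ≠ q) : flip1 n p ≠ flip1 n q := by
  rcases flip1_cases hp hpn with h | ⟨a, h⟩ | ⟨a, h⟩ | ⟨a, h⟩ <;>
  rcases flip1_cases hq hqn with k | ⟨b, k⟩ | ⟨b, k⟩ | ⟨b, k⟩ <;> omega

/-- A reflection of the `n`-gon preserves cyclic distance, and moves a pair to a neighbour on its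
orbit path or fixes it. -/
theorem orbit_flip1 {n p q : ℕ} (hp : 1 ≤ p) (hpn : p ≤ n) (hq : 1 ≤ q) (hqn : q ≤ n)
    (hpq : p ≠ q) :
    orbitIndex n (flip1 n p) (flip1 n q) = orbitIndex n p q ∧
      orbitPos n p q ≤ orbitPos n (flip1 n p) (flip1 n q) + 1 ∧
      orbitPos n (flip1 n p) (flip1 n q) ≤ orbitPos n p q + 1 := by
  have hne := flip1_ne hp hpn hq hqn hpq
  have hp' := flip1_mem hp hpn
  have hq' := flip1_mem hq hqn
  have hO := orbit_cases hp hpn hq hqn hpq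
  have hO' := orbit_cases hp'.1 hp'.2 hq'.1 hq'.2 hne
  rcases flip1_cases hp hpn with h | ⟨a, h⟩ | ⟨a, h⟩ | ⟨a, h⟩ <;>
  rcases flip1_cases hq hqn with k | ⟨b, k⟩ | ⟨b, k⟩ | ⟨b, k⟩ <;>
  rcases hO with ⟨c, hO⟩ | ⟨c, hO⟩ | ⟨c, hO⟩ <;> first | omega |
    (rcases hO' with ⟨d, hO'⟩ | ⟨d, hO'⟩ | ⟨d, hO'⟩ <;> omega)

theorem flip2_ne {n p q : ℕ} (hp : 1 ≤ p) (hpn : p ≤ n) (hq : 1 ≤ q) (hqn : q ≤ n)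
    (hpq : p ≠ q) : flip2 n p ≠ flip2 n q := by
  rcases flip2_cases hp hpn with ⟨a, h⟩ | ⟨a, h⟩ | ⟨a, h⟩ <;>
  rcases flip2_cases hq hqn with ⟨b, k⟩ | ⟨b, k⟩ | ⟨b, k⟩ <;> omega

theorem orbit_flip2 {n p q : ℕ} (hp : 1 ≤ p) (hpn : p ≤ n) (hq : 1 ≤ q) (hqn : q ≤ n)
    (hpq : p ≠ q) :
    orbitIndex n (flip2 n p) (flip2 n q) = orbitIndex n p q ∧
      orbitPos n p q ≤ orbitPos n (flip2 n p) (flip2 n q) + 1 ∧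
      orbitPos n (flip2 n p) (flip2 n q) ≤ orbitPos n p q + 1 := by
  have hne := flip2_ne hp hpn hq hqn hpq
  have hp' := flip2_mem hp hpn
  have hq' := flip2_mem hq hqn
  have hO := orbit_cases hp hpn hq hqn hpq
  have hO' := orbit_cases hp'.1 hp'.2 hq'.1 hq'.2 hne
  rcases flip2_cases hp hpn with ⟨a, h⟩ | ⟨a, h⟩ | ⟨a, h⟩ <;>
  rcases flip2_cases hq hqn with ⟨b, k⟩ | ⟨b, k⟩ | ⟨b, k⟩ <;>
  rcases hO with ⟨c, hO⟩ | ⟨c, hO⟩ | ⟨c, hO⟩ <;> first | omega |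
    (rcases hO' with ⟨d, hO'⟩ | ⟨d, hO'⟩ | ⟨d, hO'⟩ <;> omega)

theorem orbitPos_flip_pred {n p q : ℕ} (hp : 1 ≤ p) (hlt : p < q) (hqn : q ≤ n)
    (h0 : 0 < orbitPos n p q) :
    orbitPos n (flip1 n p) (flip1 n q) + 1 = orbitPos n p q ∨
      orbitPos n (flip2 n p) (flip2 n q) + 1 = orbitPos n p q := by
  have hpn : p ≤ n := hlt.le.trans hqn
  have hq : 1 ≤ q := hp.trans hlt.le
  have hpq : p ≠ q := hlt.ne
  rcases orbit_cases hp hpn hq hqn hpq with ⟨c, hO⟩ | ⟨c, hO⟩ | ⟨c, hO⟩ <;>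
  rcases flip1_cases hp hpn with h | ⟨a, h⟩ | ⟨a, h⟩ | ⟨a, h⟩ <;> (try omega) <;>
  rcases flip1_cases hq hqn with k | ⟨b, k⟩ | ⟨b, k⟩ | ⟨b, k⟩ <;>
  first
  | omega
  | (left
     have hne := flip1_ne hp hpn hq hqn hpq
     have hp' := flip1_mem hp hpn
     have hq' := flip1_mem hq hqn
     rcases orbit_cases hp'.1 hp'.2 hq'.1 hq'.2 hne with ⟨d, hO'⟩ | ⟨d, hO'⟩ | ⟨d, hO'⟩ <;> omega)
  | (right
     have hne := flip2_ne hp hpn hq hqn hpq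
     have hp' := flip2_mem hp hpn
     have hq' := flip2_mem hq hqn
     rcases flip2_cases hp hpn with ⟨a2, h2⟩ | ⟨a2, h2⟩ | ⟨a2, h2⟩ <;> (try omega) <;>
     rcases flip2_cases hq hqn with ⟨b2, k2⟩ | ⟨b2, k2⟩ | ⟨b2, k2⟩ <;> (try omega) <;>
     rcases orbit_cases hp'.1 hp'.2 hq'.1 hq'.2 hne with ⟨d, hO'⟩ | ⟨d, hO'⟩ | ⟨d, hO'⟩ <;> omega)

/-- The second bound is needed because the orbit of diametrically opposite pairs, of index `n`, has
only `n / 2` positions. -/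
theorem orbitPos_flip_succ {n p q : ℕ} (hp : 1 ≤ p) (hlt : p < q) (hqn : q ≤ n)
    (h0 : orbitPos n p q + 1 < n)
    (h0' : orbitIndex n p q = n → orbitPos n p q + 1 < n / 2) :
    orbitPos n (flip1 n p) (flip1 n q) = orbitPos n p q + 1 ∨
      orbitPos n (flip2 n p) (flip2 n q) = orbitPos n p q + 1 := by
  have hpn : p ≤ n := hlt.le.trans hqn
  have hq : 1 ≤ q := hp.trans hlt.le
  have hpq : p ≠ q := hlt.ne
  rcases orbit_cases hp hpn hq hqn hpq with ⟨c, hO⟩ | ⟨c, hO⟩ | ⟨c, hO⟩ <;>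
  rcases flip1_cases hp hpn with h | ⟨a, h⟩ | ⟨a, h⟩ | ⟨a, h⟩ <;> (try omega) <;>
  rcases flip1_cases hq hqn with k | ⟨b, k⟩ | ⟨b, k⟩ | ⟨b, k⟩ <;>
  first
  | omega
  | (left
     have hne := flip1_ne hp hpn hq hqn hpq
     have hp' := flip1_mem hp hpn
     have hq' := flip1_mem hq hqn
     rcases orbit_cases hp'.1 hp'.2 hq'.1 hq'.2 hne with ⟨d, hO'⟩ | ⟨d, hO'⟩ | ⟨d, hO'⟩ <;> omega)
  | (right
     have hne := flip2_ne hp hpn hq hqn hpq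
     have hp' := flip2_mem hp hpn
     have hq' := flip2_mem hq hqn
     rcases flip2_cases hp hpn with ⟨a2, h2⟩ | ⟨a2, h2⟩ | ⟨a2, h2⟩ <;> (try omega) <;>
     rcases flip2_cases hq hqn with ⟨b2, k2⟩ | ⟨b2, k2⟩ | ⟨b2, k2⟩ <;> (try omega) <;>
     rcases orbit_cases hp'.1 hp'.2 hq'.1 hq'.2 hne with ⟨d, hO'⟩ | ⟨d, hO'⟩ | ⟨d, hO'⟩ <;> omega)

/-! ### The potential given by exit positions and exit costs -/

/-- On the orbit with index `d` this is `C d` plus the distance to the position `X d`. -/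
def potential (X C : ℕ → ℕ) (n p q : ℕ) : ℕ :=
  if p = q then 0 else
    (orbitPos n p q - X (orbitIndex n p q)) + (X (orbitIndex n p q) - orbitPos n p q) +
      C (orbitIndex n p q)

theorem potential_comm (X C : ℕ → ℕ) (n p q : ℕ) : potential X C n p q = potential X C n q p := by
  simp only [potential, orbitIndex_comm n p q, orbitPos_comm n p q, eq_comm (a := p)]

/-- The potential as a function on the vertices of the square graph. -/
def pairPotential (X C : ℕ → ℕ) (n : ℕ) : Sym2 (State n) → ℕ :=
  Sym2.lift ⟨fun p q => potential X C n p q, fun p q => potential_comm X C n p q⟩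

section Automaton

variable {n : ℕ} {i j : State n} {X C : ℕ → ℕ}

theorem autA_pert_val (x : State n) :
    (autA n i j x Letter.pert : ℕ) = if (x : ℕ) = i then (j : ℕ) else x := by
  unfold autA
  by_cases h : x = i
  · simp [h]
  · have h' : (x : ℕ) ≠ i := fun h'' => h (Subtype.ext h'')
    simp [h, h']

theorem autA_one_val (x : State n) : (autA n i j x Letter.one : ℕ) = flip1 n x := rfl

theorem autA_two_val (x : State n) : (autA n i j x Letter.two : ℕ) = flip2 n x := rfl

theorem pairPotential_of_isDiag (u : Sym2 (State n)) (hu : u.IsDiag) :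
    pairPotential X C n u = 0 := by
  induction u with
  | _ p q =>
    obtain rfl : p = q := by simpa using hu
    simp [pairPotential, potential]

/-- The letters `one` and `two` keep the orbit and change the position by at most one, so only the
third letter imposes a condition on `X` and `C`. -/
theorem pairPotential_le_map_add_one
    (hpert : ∀ q, 1 ≤ q → q ≤ n → q ≠ i → potential X C n i q ≤ potential X C n j q + 1)
    (u : Sym2 (State n)) (a : Letter) :
    pairPotential X C n u ≤ pairPotential X C n (u.map fun q => autA n i j q a) + 1 := by
  induction u with
  | _ p q =>
    have hp := Finset.mem_Icc.1 p.2
    have hq := Finset.mem_Icc.1 q.2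
    rw [Sym2.map_mk]
    change potential X C n p q ≤ potential X C n (autA n i j p a) (autA n i j q a) + 1
    by_cases hpq : (p : ℕ) = q
    · simp [potential, hpq]
    cases a with
    | pert =>
      rw [autA_pert_val, autA_pert_val]
      by_cases h1 : (p : ℕ) = i
      · have h2 : (q : ℕ) ≠ i := fun h => hpq (h1.trans h.symm)
        rw [if_pos h1, if_neg h2, h1]
        exact hpert q hq.1 hq.2 h2
      · by_cases h2 : (q : ℕ) = i
        · rw [if_neg h1, if_pos h2, h2, potential_comm X C n p i, potential_comm X C n p j]
          exact hpert p hp.1 hp.2 h1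
        · rw [if_neg h1, if_neg h2]
          omega
    | one =>
      rw [autA_one_val, autA_one_val]
      have hne := flip1_ne hp.1 hp.2 hq.1 hq.2 hpq
      obtain ⟨h1, h2, h3⟩ := orbit_flip1 hp.1 hp.2 hq.1 hq.2 hpq
      simp only [potential, if_neg hpq, if_neg hne, h1]
      omega
    | two =>
      rw [autA_two_val, autA_two_val]
      have hne := flip2_ne hp.1 hp.2 hq.1 hq.2 hpq
      obtain ⟨h1, h2, h3⟩ := orbit_flip2 hp.1 hp.2 hq.1 hq.2 hpq
      simp only [potential, if_neg hpq, if_neg hne, h1]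
      omega

theorem exists_flip_potential_lt {p q : ℕ} (hp : 1 ≤ p) (hpq : p < q) (hq : q ≤ n)
    (hX : X (orbitIndex n p q) < n)
    (hX' : orbitIndex n p q = n → X (orbitIndex n p q) < n / 2)
    (hne : orbitPos n p q ≠ X (orbitIndex n p q)) :
    potential X C n (flip1 n p) (flip1 n q) < potential X C n p q ∨
      potential X C n (flip2 n p) (flip2 n q) < potential X C n p q := by
  have hpn : p ≤ n := by omega
  have hq1 : 1 ≤ q := by omega
  have ne1 := flip1_ne hp hpn hq1 hq hpq.ne
  have ne2 := flip2_ne hp hpn hq1 hq hpq.ne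
  have e1 := (orbit_flip1 hp hpn hq1 hq hpq.ne).1
  have e2 := (orbit_flip2 hp hpn hq1 hq hpq.ne).1
  simp only [potential, if_neg hpq.ne, if_neg ne1, if_neg ne2, e1, e2]
  rcases Nat.lt_or_gt_of_ne hne with h | h
  · have := orbitPos_flip_succ hp hpq hq (by omega) (by omega)
    omega
  · have := orbitPos_flip_pred hp hpq hq (by omega)
    omega

/-- Away from the exit one of the two reflections moves towards it; at the exit, which contains `i`,
the third letter lowers the potential. -/
theorem exists_pairPotential_map_lt
    (hX : ∀ p q, 1 ≤ p → p < q → q ≤ n → X (orbitIndex n p q) < n ∧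
      (orbitIndex n p q = n → X (orbitIndex n p q) < n / 2))
    (hexit : ∀ p q, 1 ≤ p → p < q → q ≤ n → orbitPos n p q = X (orbitIndex n p q) →
      p = i ∨ q = i)
    (hpert : ∀ q, 1 ≤ q → q ≤ n → q ≠ i → orbitPos n i q = X (orbitIndex n i q) →
      potential X C n j q < potential X C n i q)
    (u : Sym2 (State n)) (hu : ¬ u.IsDiag) :
    ∃ a, pairPotential X C n (u.map fun q => autA n i j q a) < pairPotential X C n u := by
  obtain ⟨p, q, hpq, rfl⟩ : ∃ p q : State n, (p : ℕ) < q ∧ s(p, q) = u := by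
    induction u with
    | _ p q =>
      have hne : (p : ℕ) ≠ q := fun h => hu (by simpa using Subtype.ext h)
      rcases Nat.lt_or_gt_of_ne hne with h | h
      · exact ⟨p, q, h, rfl⟩
      · exact ⟨q, p, h, Sym2.eq_swap⟩
  have hp := Finset.mem_Icc.1 p.2
  have hq := Finset.mem_Icc.1 q.2
  simp_rw [Sym2.map_mk]
  change ∃ a, potential X C n (autA n i j p a) (autA n i j q a) < potential X C n p q
  by_cases h : orbitPos n p q = X (orbitIndex n p q)
  · refine ⟨Letter.pert, ?_⟩
    rw [autA_pert_val, autA_pert_val]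
    rcases hexit p q hp.1 hpq hq.2 h with h1 | h1
    · have h2 : (q : ℕ) ≠ i := by omega
      rw [if_pos h1, if_neg h2, h1]
      exact hpert q hq.1 hq.2 h2 (h1 ▸ h)
    · have h2 : (p : ℕ) ≠ i := by omega
      rw [if_neg h2, if_pos h1, h1, potential_comm X C n p i, potential_comm X C n p j]
      refine hpert p hp.1 hp.2 h2 ?_
      rw [orbitPos_comm n i p, orbitIndex_comm n i p, ← h1]
      exact h
  · obtain ⟨h1, h2⟩ := hX p q hp.1 hpq hq.2
    rcases exists_flip_potential_lt (C := C) hp.1 hpq hq.2 h1 h2 h with h3 | h3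
    · exact ⟨Letter.one, h3⟩
    · exact ⟨Letter.two, h3⟩

theorem autA_squareDiam_and_sync {M : ℕ} {d b : ℚ}
    (hX : ∀ p q, 1 ≤ p → p < q → q ≤ n → X (orbitIndex n p q) < n ∧
      (orbitIndex n p q = n → X (orbitIndex n p q) < n / 2))
    (hexit : ∀ p q, 1 ≤ p → p < q → q ≤ n → orbitPos n p q = X (orbitIndex n p q) →
      p = i ∨ q = i)
    (hpert : ∀ q, 1 ≤ q → q ≤ n → q ≠ i → potential X C n i q ≤ potential X C n j q + 1 ∧
      (orbitPos n i q = X (orbitIndex n i q) → potential X C n j q < potential X C n i q))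
    (hle : ∀ p q, 1 ≤ p → p < q → q ≤ n → potential X C n p q ≤ M)
    (hM : ∃ p q, 1 ≤ p ∧ p < q ∧ q ≤ n ∧ potential X C n p q = M)
    (hd : (M : ℚ) = d) (hb : b ≤ M) :
    HasSquareDiam (autA n i j) d ∧ SyncWithThresholdGE (autA n i j) b := by
  have h1 := pairPotential_of_isDiag (n := n) (X := X) (C := C)
  have h2 := pairPotential_le_map_add_one fun q hq hq' hqi => (hpert q hq hq' hqi).1
  have h3 := exists_pairPotential_map_lt hX hexit fun q hq hq' hqi => (hpert q hq hq' hqi).2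
  have h4 : ∃ u : Sym2 (State n), ¬ u.IsDiag ∧ pairPotential X C n u = M := by
    obtain ⟨p, q, hp, hpq, hq, h⟩ := hM
    refine ⟨s(⟨p, Finset.mem_Icc.2 (by omega)⟩, ⟨q, Finset.mem_Icc.2 (by omega)⟩), ?_, h⟩
    simpa using hpq.ne
  have h5 : ∀ u : Sym2 (State n), pairPotential X C n u ≤ M := by
    intro u
    induction u with
    | _ p q =>
      have hp := Finset.mem_Icc.1 p.2
      have hq := Finset.mem_Icc.1 q.2
      change potential X C n p q ≤ M
      rcases Nat.lt_trichotomy p q with h | h | h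
      · exact hle p q hp.1 h hq.2
      · simp [potential, h]
      · rw [potential_comm]
        exact hle q p hq.1 h hp.2
  refine ⟨⟨M, squareDiam_eq h1 h2 h3 h5 h4, hd⟩, ?_⟩
  have : Nonempty (State n) := ⟨i⟩
  obtain ⟨u, -, hu⟩ := h4
  exact syncWithThresholdGE_of_potential h1 h2 h3 ⟨u, by rwa [hu]⟩

end Automaton

/-! ### The odd families, with `n = 2 h + 1`, `i = h`, `j = h + 1` -/

/-- The order in which a shortest merging path runs through the orbits of pairs,
for `𝒜_{h, h+1}` on `2 h + 1` states. -/
def oddRank (h d : ℕ) : ℕ := if d ≤ h then d else 2 * h + 1 - d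

/-- The position on the orbit with index `d` at which a shortest merging path leaves it,
for `𝒜_{h, h+1}` on `2 h + 1` states. -/
def oddExit (h d : ℕ) : ℕ := if d ≤ h then h + d / 2 - 1 else h - 1 - d / 2

/-- The distance from the exit position of the orbit of rank `e` to the singletons. -/
def oddCost (h e : ℕ) : ℕ :=
  if e % 2 = 0 then (h + 1) * e else (h + 2) * (e - 1) + (2 - e)

theorem oddCost_two_mul_add_one (h m : ℕ) :
    oddCost h (2 * m + 1) = oddCost h (2 * m) + 2 * m + (1 - m) := by
  have h1 : (2 * m + 1) % 2 ≠ 0 := by omega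
  have h2 : (2 * m) % 2 = 0 := by omega
  have h3 : 2 - (2 * m + 1) = 1 - m := by omega
  simp only [oddCost, if_neg h1, if_pos h2, Nat.add_sub_cancel, h3]
  ring

theorem oddCost_two_mul_add_two (h m : ℕ) :
    oddCost h (2 * (m + 1)) + 2 * m + (1 - m) =
      oddCost h (2 * m + 1) + 2 * h + 2 := by
  rw [oddCost_two_mul_add_one]
  have h1 : (2 * (m + 1)) % 2 = 0 := by omega
  have h2 : (2 * m) % 2 = 0 := by omega
  simp only [oddCost, if_pos h1, if_pos h2]
  ring

/-- Small indices get even ranks and exit at `{h, h + d}`; large ones get odd ranks and exit at `{h,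
d + 1 - h}`. For `d = 2 h` the truncated `m - 1` is 0, rightly the position of `{h, h + 1}`. -/
theorem oddRank_oddExit_cases {h d : ℕ} (hd : d % 2 = 0) (hdn : d ≤ 2 * h) :
    (∃ m, d = 2 * m ∧ 2 * m ≤ h ∧ oddRank h d = 2 * m ∧ oddExit h d = h + m - 1) ∨
    (∃ m, d + 2 * m = 2 * h ∧ 2 * m + 1 ≤ h ∧ oddRank h d = 2 * m + 1 ∧ oddExit h d = m - 1) := by
  unfold oddRank oddExit
  by_cases h1 : d ≤ h
  · refine Or.inl ⟨d / 2, ?_⟩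
    simp only [if_pos h1, and_true]
    omega
  · refine Or.inr ⟨h - d / 2, ?_⟩
    simp only [if_neg h1]
    omega

theorem orbitIndex_even {n p q : ℕ} (hp : 1 ≤ p) (hpn : p ≤ n) (hq : 1 ≤ q) (hqn : q ≤ n)
    (hpq : p ≠ q) : orbitIndex n p q % 2 = 0 ∧ 2 ≤ orbitIndex n p q ∧ orbitIndex n p q ≤ n := by
  rcases orbit_cases hp hpn hq hqn hpq with ⟨c, hO⟩ | ⟨c, hO⟩ | ⟨c, hO⟩ <;> omega

set_option maxHeartbeats 2000000 in
-- Replacing `h` by `h + 1` changes the rank of the orbit by at most one, so only differences of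
-- consecutive values of `oddCost` enter, and these are linear in `h` and `m`.
theorem potential_odd_pert {h q : ℕ} (hh : 2 ≤ h) (hq : 1 ≤ q) (hqn : q ≤ 2 * h + 1)
    (hqh : q ≠ h) :
    potential (oddExit h) (fun d => oddCost h (oddRank h d)) (2 * h + 1) h q ≤
      potential (oddExit h) (fun d => oddCost h (oddRank h d)) (2 * h + 1) (h + 1) q + 1 ∧
    (orbitPos (2 * h + 1) h q = oddExit h (orbitIndex (2 * h + 1) h q) →
      potential (oddExit h) (fun d => oddCost h (oddRank h d)) (2 * h + 1) (h + 1) q <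
        potential (oddExit h) (fun d => oddCost h (oddRank h d)) (2 * h + 1) h q) := by
  have hO := orbit_cases (n := 2 * h + 1) (by omega) (by omega) hq hqn hqh.symm
  have hd := orbitIndex_even (n := 2 * h + 1) (by omega) (by omega) hq hqn hqh.symm
  have hS := oddRank_oddExit_cases (h := h) hd.1 (by omega)
  by_cases hqj : q = h + 1
  · subst hqj
    have h1 : oddCost h 1 = 1 := by simp [oddCost]
    simp only [potential, if_neg hqh.symm, if_true]
    rcases hO with ⟨c, hO⟩ | ⟨c, hO⟩ | ⟨c, hO⟩ <;> (try omega) <;>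
    rcases hS with ⟨m, hS⟩ | ⟨m, hS⟩ <;> (try omega)
    -- The pair `{h, h + 1}` lies on the orbit of rank 1, at its exit, and is merged at cost 1.
    obtain rfl : m = 0 := by omega
    rw [hS.2.2.1, hS.2.2.2, h1]
    omega
  have hqj' : h + 1 ≠ q := Ne.symm hqj
  have hO' := orbit_cases (n := 2 * h + 1) (by omega : 1 ≤ h + 1) (by omega) hq hqn hqj'
  have hd' := orbitIndex_even (n := 2 * h + 1) (by omega : 1 ≤ h + 1) (by omega) hq hqn hqj'
  have hS' := oddRank_oddExit_cases (h := h) hd'.1 (by omega)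
  simp only [potential, if_neg hqh.symm, if_neg hqj']
  generalize orbitIndex (2 * h + 1) h q = d at *
  generalize orbitPos (2 * h + 1) h q = y at *
  generalize orbitIndex (2 * h + 1) (h + 1) q = d' at *
  generalize orbitPos (2 * h + 1) (h + 1) q = y' at *
  rcases hS with ⟨m, hm, hmh, hr, hX⟩ | ⟨m, hm, hmh, hr, hX⟩ <;>
  rcases hS' with ⟨m', hm', hmh', hr', hX'⟩ | ⟨m', hm', hmh', hr', hX'⟩ <;>
  rw [hr, hr', hX, hX'] <;> clear hr hr' hX hX' <;>
  rcases hO with ⟨c, hO⟩ | ⟨c, hO⟩ | ⟨c, hO⟩ <;> (try omega) <;>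
  rcases hO' with ⟨c', hO'⟩ | ⟨c', hO'⟩ | ⟨c', hO'⟩ <;> (try omega) <;>
  (have hrel : m = m' ∨ m = m' + 1 ∨ m' = m + 1 := by omega
   rcases hrel with rfl | rfl | rfl
   · have h1 := oddCost_two_mul_add_one h m
     clear hd hd'
     omega
   · have h1 := oddCost_two_mul_add_two h m'
     clear hd hd'
     omega
   · have h1 := oddCost_two_mul_add_two h m
     clear hd hd'
     omega)

theorem oddExit_lt {h p q : ℕ} (hh : 2 ≤ h) (hp : 1 ≤ p) (hpq : p < q) (hq : q ≤ 2 * h + 1) :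
    oddExit h (orbitIndex (2 * h + 1) p q) < 2 * h + 1 ∧
      (orbitIndex (2 * h + 1) p q = 2 * h + 1 →
        oddExit h (orbitIndex (2 * h + 1) p q) < (2 * h + 1) / 2) := by
  unfold oddExit
  rcases orbit_cases (n := 2 * h + 1) hp (by omega) (by omega) hq hpq.ne with
    ⟨c, hO⟩ | ⟨c, hO⟩ | ⟨c, hO⟩ <;> split_ifs <;> omega

theorem eq_of_orbitPos_eq_oddExit {h p q : ℕ} (hh : 2 ≤ h) (hp : 1 ≤ p) (hpq : p < q)
    (hq : q ≤ 2 * h + 1)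
    (hX : orbitPos (2 * h + 1) p q = oddExit h (orbitIndex (2 * h + 1) p q)) :
    p = h ∨ q = h := by
  unfold oddExit at hX
  rcases orbit_cases (n := 2 * h + 1) hp (by omega) (by omega) hq hpq.ne with
    ⟨c, hO⟩ | ⟨c, hO⟩ | ⟨c, hO⟩ <;> split_ifs at hX <;> omega

theorem potential_odd_le {h p q : ℕ} (hh : 2 ≤ h) (hp : 1 ≤ p) (hpq : p < q)
    (hq : q ≤ 2 * h + 1) :
    potential (oddExit h) (fun d => oddCost h (oddRank h d)) (2 * h + 1) p q ≤
      h * h + (5 * h - 1) / 2 := by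
  have hd := orbitIndex_even (n := 2 * h + 1) hp (by omega) (by omega) hq hpq.ne
  have hO := orbit_cases (n := 2 * h + 1) hp (by omega) (by omega) hq hpq.ne
  simp only [potential, if_neg hpq.ne]
  have hy : orbitPos (2 * h + 1) p q ≤ 2 * h := by
    rcases hO with ⟨c, hO⟩ | ⟨c, hO⟩ | ⟨c, hO⟩ <;> omega
  clear hO
  generalize orbitIndex (2 * h + 1) p q = d at *
  generalize orbitPos (2 * h + 1) p q = y at *
  rcases oddRank_oddExit_cases (h := h) hd.1 (by omega) with
    ⟨m, hm, hmh, hr, hX⟩ | ⟨m, hm, hmh, hr, hX⟩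
  · rw [hr, hX]
    have h1 : (2 * m) % 2 = 0 := by omega
    simp only [oddCost, if_pos h1]
    -- Here `t` counts the ranks above the present one; the product `h * t` is the slack in the
    -- bound.
    obtain ⟨t, rfl⟩ : ∃ t, h = 2 * m + t := ⟨h - 2 * m, by omega⟩
    have h2 : (2 * m + t + 1) * (2 * m) + (2 * m + t) * t + t =
      (2 * m + t) * (2 * m + t) + (2 * m + t) := by ring
    rcases Nat.eq_zero_or_pos t with rfl | ht
    · omega
    · have h3 : 2 * m + t ≤ (2 * m + t) * t := Nat.le_mul_of_pos_right _ ht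
      omega
  · rw [hr, hX]
    have h1 : (2 * m + 1) % 2 ≠ 0 := by omega
    simp only [oddCost, if_neg h1, Nat.add_sub_cancel]
    obtain ⟨t, rfl⟩ : ∃ t, h = 2 * m + 1 + t := ⟨h - 2 * m - 1, by omega⟩
    have h2 : (2 * m + 1 + t + 2) * (2 * m) + (2 * m + 1 + t) * (t + 1) + 2 * (t + 1) =
      (2 * m + 1 + t) * (2 * m + 1 + t) + 2 * (2 * m + 1 + t) := by ring
    have h3 : (2 * m + 1 + t) * (t + 1) = (2 * m + 1 + t) * t + (2 * m + 1 + t) := by ring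
    rcases Nat.eq_zero_or_pos t with rfl | ht
    · omega
    · have h4 : 2 * m + 1 + t ≤ (2 * m + 1 + t) * t := Nat.le_mul_of_pos_right _ ht
      omega

/-- The maximum occurs on the orbit of last rank `h`, at the end farther from its exit: position 0
of the orbit `d = h` if `h` is even, the last position `2 h` of the orbit `d = h + 1` if `h` is odd.
-/
theorem exists_potential_odd_eq {h : ℕ} (hh : 2 ≤ h) :
    ∃ p q, 1 ≤ p ∧ p < q ∧ q ≤ 2 * h + 1 ∧
      potential (oddExit h) (fun d => oddCost h (oddRank h d)) (2 * h + 1) p q =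
        h * h + (5 * h - 1) / 2 := by
  rcases Nat.mod_two_eq_zero_or_one h with h0 | h0
  · obtain ⟨k, rfl⟩ : ∃ k, h = 2 * k := ⟨h / 2, by omega⟩
    have hd : orbitIndex (2 * (2 * k) + 1) k (k + 1) = 2 * k := by unfold orbitIndex; split_ifs <;> omega
    have hy : orbitPos (2 * (2 * k) + 1) k (k + 1) = 0 := by unfold orbitPos; split_ifs <;> omega
    refine ⟨k, k + 1, by omega, by omega, by omega, ?_⟩
    simp only [potential, hd, hy, oddExit, oddRank, le_refl, if_true, oddCost, if_pos h0]
    have : (2 * k + 1) * (2 * k) = 2 * k * (2 * k) + 2 * k := by ring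
    split_ifs <;> omega
  · obtain ⟨k, rfl⟩ : ∃ k, h = 2 * k + 1 := ⟨h / 2, by omega⟩
    have hd : orbitIndex (2 * (2 * k + 1) + 1) (3 * k + 2) (3 * k + 3) = 2 * k + 2 := by
      unfold orbitIndex; split_ifs <;> omega
    have hy : orbitPos (2 * (2 * k + 1) + 1) (3 * k + 2) (3 * k + 3) = 4 * k + 2 := by
      unfold orbitPos; split_ifs <;> omega
    refine ⟨3 * k + 2, 3 * k + 3, by omega, by omega, by omega, ?_⟩
    have h1 : ¬ 2 * k + 2 ≤ 2 * k + 1 := by omega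
    have h2 : 2 * (2 * k + 1) + 1 - (2 * k + 2) = 2 * k + 1 := by omega
    have h3 : ¬ (2 * k + 1) % 2 = 0 := by omega
    have h4 : 3 * k + 2 ≠ 3 * k + 3 := by omega
    simp only [potential, if_neg h4, hd, hy, oddExit, oddRank, if_neg h1, h2, oddCost, if_neg h3,
      Nat.add_sub_cancel]
    have : (2 * k + 1 + 2) * (2 * k) = (2 * k + 1) * (2 * k + 1) + (2 * k - 1) := by
      obtain ⟨j, rfl⟩ : ∃ j, k = j + 1 := ⟨k - 1, by omega⟩
      rw [show 2 * (j + 1) - 1 = 2 * j + 1 by omega]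
      ring
    omega

theorem autA_odd_squareDiam_and_sync {n h : ℕ} (hh : 2 ≤ h) (hn : n = 2 * h + 1) {i j : State n}
    (hi : (i : ℕ) = h) (hj : (j : ℕ) = h + 1) :
    HasSquareDiam (autA n i j)
        ((h * h + (5 * h - 1) / 2 : ℕ) : ℚ) ∧
      SyncWithThresholdGE (autA n i j) ((n : ℚ) ^ 2 / 4) := by
  subst hn
  refine autA_squareDiam_and_sync (X := oddExit h) (C := fun d => oddCost h (oddRank h d))
    (fun p q hp hpq hq => oddExit_lt hh hp hpq hq) ?_ ?_
    (fun p q hp hpq hq => potential_odd_le hh hp hpq hq) (exists_potential_odd_eq hh) rfl ?_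
  · intro p q hp hpq hq hX
    rw [hi]
    exact eq_of_orbitPos_eq_oddExit hh hp hpq hq hX
  · intro q hq hqn hqi
    rw [hi, hj]
    exact potential_odd_pert hh hq hqn (hi ▸ hqi)
  · have h1 : h * h + h + 1 ≤ h * h + (5 * h - 1) / 2 := by omega
    have h2 : ((h * h + h + 1 : ℕ) : ℚ) ≤ ((h * h + (5 * h - 1) / 2 : ℕ) : ℚ) := by
      exact_mod_cast h1
    refine le_trans ?_ h2
    push_cast
    nlinarith

/-! ### Evaluating orbit coordinates and potentials, for the even families -/

theorem orbitIndex_of_even_add {n p q : ℕ} (h : (p + q) % 2 = 0) :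
    orbitIndex n p q = (p - q) + (q - p) ∧ orbitPos n p q = (p + q) / 2 - 1 := by
  simp only [orbitIndex, orbitPos, if_pos h, and_self]

theorem orbitIndex_of_odd_add_le {n p q : ℕ} (h : (p + q) % 2 = 1) (hn : p + q ≤ n + 1) :
    orbitIndex n p q = p + q - 1 ∧ orbitPos n p q = ((p - q) + (q - p) - 1) / 2 := by
  have h' : (p + q) % 2 ≠ 0 := by omega
  simp only [orbitIndex, orbitPos, if_neg h', if_pos hn, and_self]

theorem orbitIndex_of_odd_add_gt {n p q : ℕ} (h : (p + q) % 2 = 1) (hn : n + 1 < p + q) :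
    orbitIndex n p q = 2 * n + 1 - (p + q) ∧
      orbitPos n p q = n - 1 - ((p - q) + (q - p) - 1) / 2 := by
  have h' : (p + q) % 2 ≠ 0 := by omega
  simp only [orbitIndex, orbitPos, if_neg h', if_neg hn.not_ge, and_self]

theorem potential_eq {X C : ℕ → ℕ} {n p q d y x c : ℕ} (hpq : p ≠ q) (hd : orbitIndex n p q = d)
    (hy : orbitPos n p q = y) (hx : X d = x) (hc : C d = c) :
    potential X C n p q = (y - x) + (x - y) + c := by
  rw [potential, if_neg hpq, hd, hy, hx, hc]

/-! ### The family `n = 4 k`, `i = 1`, `j = 4 k - 2` -/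

/-- The position on the orbit with index `d` at which a shortest merging path leaves it,
for `𝒜_{1, 4 k - 2}` on `4 k` states. -/
def fourExit (k d : ℕ) : ℕ := if d % 4 = 0 ∧ d < 4 * k then d / 2 else d / 2 - 1

/-- The distance from the exit position of the orbit with index `d` to the singletons,
for `𝒜_{1, 4 k - 2}` on `4 k` states. -/
def fourCost (k d : ℕ) : ℕ :=
  if d % 4 = 0 then 4 * (k * (d / 4 - 1)) + d + (if d < 4 * k then 3 else 0)
  else 4 * (k * (k - 1 - d / 4)) + 1

theorem fourExit_fourCost_of_lt {k m : ℕ} (hm : m + 1 < k) :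
    fourExit k (4 * (m + 1)) = 2 * m + 2 ∧
      fourCost k (4 * (m + 1)) = 4 * (k * m) + 4 * m + 7 := by
  have h1 : (4 * (m + 1)) % 4 = 0 := by omega
  have h2 : 4 * (m + 1) < 4 * k := by omega
  have h3 : 4 * (m + 1) / 4 - 1 = m := by omega
  simp only [fourExit, fourCost, h1, h2, h3, and_self, if_true]
  omega

theorem fourExit_fourCost_top {m : ℕ} :
    fourExit (m + 1) (4 * (m + 1)) = 2 * m + 1 ∧
      fourCost (m + 1) (4 * (m + 1)) = 4 * ((m + 1) * m) + 4 * m + 4 := by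
  have h1 : (4 * (m + 1)) % 4 = 0 := by omega
  have h2 : ¬ 4 * (m + 1) < 4 * (m + 1) := by omega
  have h3 : 4 * (m + 1) / 4 - 1 = m := by omega
  simp only [fourExit, fourCost, h1, h2, h3, and_false, if_true, if_false]
  omega

theorem fourExit_fourCost_odd {k m d : ℕ} (hm : d + 4 * m + 2 = 4 * k) :
    fourExit k d = 2 * k - 2 * m - 2 ∧ fourCost k d = 4 * (k * m) + 1 := by
  have h1 : d % 4 ≠ 0 := by omega
  have h3 : k - 1 - d / 4 = m := by omega
  simp only [fourExit, fourCost, h1, h3, false_and, if_false, and_true]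
  omega

/-- The pairs containing 1 are `{1, d}` at position `d / 2 - 1` and `{1, d + 1}` at `d / 2`.
Multiples of 4 exit at the latter, the others at the former. The orbit `d = 4 k` is an exception,
because `d + 1` is no longer a state. -/
theorem fourExit_fourCost_cases {k d : ℕ} (hd : d % 2 = 0) (hd2 : 2 ≤ d) (hdk : d ≤ 4 * k) :
    (∃ m, d = 4 * (m + 1) ∧ m + 1 < k ∧ fourExit k d = 2 * m + 2 ∧
      fourCost k d = 4 * (k * m) + 4 * m + 7) ∨
    (∃ m, d = 4 * (m + 1) ∧ k = m + 1 ∧ fourExit k d = 2 * m + 1 ∧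
      fourCost k d = 4 * (k * m) + 4 * m + 4) ∨
    (∃ m, d + 4 * m + 2 = 4 * k ∧ fourExit k d = 2 * k - 2 * m - 2 ∧
      fourCost k d = 4 * (k * m) + 1) := by
  by_cases h : d % 4 = 0
  · obtain ⟨m, rfl⟩ : ∃ m, d = 4 * (m + 1) := ⟨d / 4 - 1, by omega⟩
    by_cases hm : m + 1 < k
    · exact Or.inl ⟨m, rfl, hm, fourExit_fourCost_of_lt hm⟩
    · obtain rfl : k = m + 1 := by omega
      exact Or.inr (Or.inl ⟨m, rfl, rfl, fourExit_fourCost_top⟩)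
  · have hm : d + 4 * (k - 1 - d / 4) + 2 = 4 * k := by omega
    exact Or.inr (Or.inr ⟨_, hm, fourExit_fourCost_odd hm⟩)

theorem fourExit_lt {k p q : ℕ} (hp : 1 ≤ p) (hpq : p < q) (hq : q ≤ 4 * k) :
    fourExit k (orbitIndex (4 * k) p q) < 4 * k ∧
      (orbitIndex (4 * k) p q = 4 * k → fourExit k (orbitIndex (4 * k) p q) < (4 * k) / 2) := by
  unfold fourExit
  rcases orbit_cases (n := 4 * k) hp (by omega) (by omega) hq hpq.ne with
    ⟨c, hO⟩ | ⟨c, hO⟩ | ⟨c, hO⟩ <;> split_ifs <;> omega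

theorem eq_of_orbitPos_eq_fourExit {k p q : ℕ} (hp : 1 ≤ p) (hpq : p < q)
    (hq : q ≤ 4 * k) (hX : orbitPos (4 * k) p q = fourExit k (orbitIndex (4 * k) p q)) :
    p = 1 ∨ q = 1 := by
  unfold fourExit at hX
  rcases orbit_cases (n := 4 * k) hp (by omega) (by omega) hq hpq.ne with
    ⟨c, hO⟩ | ⟨c, hO⟩ | ⟨c, hO⟩ <;> split_ifs at hX <;> omega

theorem potential_four_pert_of_even {k q : ℕ} (hk : 2 ≤ k) (hq : 1 ≤ q) (hqn : q ≤ 4 * k)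
    (hq1 : q ≠ 1) (hq2 : q % 2 = 0) :
    potential (fourExit k) (fourCost k) (4 * k) 1 q ≤
      potential (fourExit k) (fourCost k) (4 * k) (4 * k - 2) q + 1 ∧
    (orbitPos (4 * k) 1 q = fourExit k (orbitIndex (4 * k) 1 q) →
      potential (fourExit k) (fourCost k) (4 * k) (4 * k - 2) q <
        potential (fourExit k) (fourCost k) (4 * k) 1 q) := by
  have hi := orbitIndex_of_odd_add_le (n := 4 * k) (p := 1) (q := q) (by omega) (by omega)
  have hj := orbitIndex_of_even_add (n := 4 * k) (p := 4 * k - 2) (q := q) (by omega)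
  by_cases hq4 : q % 4 = 0
  · by_cases hqt : q = 4 * k
    · obtain ⟨m, rfl⟩ : ∃ m, k = m + 1 := ⟨k - 1, by omega⟩
      subst hqt
      obtain ⟨hX, hC⟩ := fourExit_fourCost_top (m := m)
      obtain ⟨hX', hC'⟩ := fourExit_fourCost_odd (k := m + 1) (m := m) (d := 2) (by omega)
      have hid : orbitIndex (4 * (m + 1)) 1 (4 * (m + 1)) = 4 * (m + 1) := by omega
      rw [potential_eq (by omega) hid rfl hX hC,
        potential_eq (by omega) (hj.1.trans (by omega)) rfl hX' hC', hid]
      omega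
    · obtain ⟨m, rfl⟩ : ∃ m, q = 4 * (m + 1) := ⟨q / 4 - 1, by omega⟩
      have hid : orbitIndex (4 * k) 1 (4 * (m + 1)) = 4 * (m + 1) := by omega
      obtain ⟨hX, hC⟩ := fourExit_fourCost_of_lt (k := k) (m := m) (by omega)
      obtain ⟨hX', hC'⟩ := fourExit_fourCost_odd (k := k) (m := m + 1)
        (d := 4 * k - 4 * m - 6) (by omega)
      have hr : k * (m + 1) = k * m + k := by ring
      rw [potential_eq (by omega) hid rfl hX hC,
        potential_eq (by omega) (hj.1.trans (by omega)) rfl hX' hC', hid]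
      omega
  · obtain ⟨m, hm⟩ : ∃ m, q + 4 * m + 2 = 4 * k := ⟨k - 1 - q / 4, by omega⟩
    obtain ⟨hX, hC⟩ := fourExit_fourCost_odd hm
    have hid : orbitIndex (4 * k) 1 q = q := by omega
    rw [potential_eq (by omega) hid rfl hX hC, hid]
    rcases m with _ | m
    · have h0 : potential (fourExit k) (fourCost k) (4 * k) (4 * k - 2) q = 0 :=
        if_pos (by omega)
      rw [h0]
      omega
    · obtain ⟨hX', hC'⟩ := fourExit_fourCost_of_lt (k := k) (m := m) (by omega)
      have hr : k * (m + 1) = k * m + k := by ring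
      rw [potential_eq (by omega) (hj.1.trans (by omega)) rfl hX' hC']
      omega

theorem potential_four_pert_of_odd {k q : ℕ} (hk : 2 ≤ k) (hq : 1 ≤ q) (hqn : q ≤ 4 * k)
    (hq1 : q ≠ 1) (hq2 : q % 2 = 1) :
    potential (fourExit k) (fourCost k) (4 * k) 1 q ≤
      potential (fourExit k) (fourCost k) (4 * k) (4 * k - 2) q + 1 ∧
    (orbitPos (4 * k) 1 q = fourExit k (orbitIndex (4 * k) 1 q) →
      potential (fourExit k) (fourCost k) (4 * k) (4 * k - 2) q <
        potential (fourExit k) (fourCost k) (4 * k) 1 q) := by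
  have hi := orbitIndex_of_even_add (n := 4 * k) (p := 1) (q := q) (by omega)
  -- The only odd `q` other than 1 for which `(4 k - 2) + q` stays below `n + 1`; it leads to the
  -- last orbit `4 k`.
  by_cases hq3 : q = 3
  · subst hq3
    obtain ⟨m, rfl⟩ : ∃ m, k = m + 1 := ⟨k - 1, by omega⟩
    have hj := orbitIndex_of_odd_add_le (n := 4 * (m + 1)) (p := 4 * (m + 1) - 2) (q := 3)
      (by omega) (by omega)
    obtain ⟨hX', hC'⟩ := fourExit_fourCost_top (m := m)
    obtain ⟨hX, hC⟩ := fourExit_fourCost_odd (k := m + 1) (m := m) (d := 2) (by omega)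
    have hid : orbitIndex (4 * (m + 1)) 1 3 = 2 := by omega
    rw [potential_eq (by omega) hid rfl hX hC,
      potential_eq (by omega) (hj.1.trans (by omega)) rfl hX' hC', hid]
    omega
  · have hj := orbitIndex_of_odd_add_gt (n := 4 * k) (p := 4 * k - 2) (q := q)
      (by omega) (by omega)
    by_cases hq4 : q % 4 = 1
    · obtain ⟨m, rfl⟩ : ∃ m, q = 4 * (m + 1) + 1 := ⟨q / 4 - 1, by omega⟩
      have hid : orbitIndex (4 * k) 1 (4 * (m + 1) + 1) = 4 * (m + 1) := by omega
      obtain ⟨hX, hC⟩ := fourExit_fourCost_of_lt (k := k) (m := m) (by omega)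
      obtain ⟨hX', hC'⟩ := fourExit_fourCost_odd (k := k) (m := m)
        (d := 4 * k - 4 * m - 2) (by omega)
      rw [potential_eq (by omega) hid rfl hX hC,
        potential_eq (by omega) (hj.1.trans (by omega)) rfl hX' hC', hid]
      omega
    · obtain ⟨m, hm⟩ : ∃ m, q + 4 * m + 1 = 4 * k := ⟨k - 1 - q / 4, by omega⟩
      have hid : orbitIndex (4 * k) 1 q = q - 1 := by omega
      obtain ⟨hX, hC⟩ := fourExit_fourCost_odd (k := k) (m := m) (d := q - 1) (by omega)
      obtain ⟨hX', hC'⟩ := fourExit_fourCost_of_lt (k := k) (m := m) (by omega)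
      rw [potential_eq (by omega) hid rfl hX hC,
        potential_eq (by omega) (hj.1.trans (by omega)) rfl hX' hC', hid]
      omega

theorem potential_four_le {k p q : ℕ} (hk : 2 ≤ k) (hp : 1 ≤ p) (hpq : p < q)
    (hq : q ≤ 4 * k) :
    potential (fourExit k) (fourCost k) (4 * k) p q ≤ 4 * (k * k) + 2 * k - 1 := by
  have hO := orbit_cases (n := 4 * k) hp (by omega) (by omega) hq hpq.ne
  have hd : orbitIndex (4 * k) p q % 2 = 0 ∧ 2 ≤ orbitIndex (4 * k) p q ∧
      orbitIndex (4 * k) p q ≤ 4 * k := by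
    rcases hO with ⟨c, hO⟩ | ⟨c, hO⟩ | ⟨c, hO⟩ <;> omega
  have hy : orbitPos (4 * k) p q < 4 * k ∧
      (orbitIndex (4 * k) p q = 4 * k → orbitPos (4 * k) p q < 2 * k) := by
    rcases hO with ⟨c, hO⟩ | ⟨c, hO⟩ | ⟨c, hO⟩ <;> omega
  rw [potential, if_neg hpq.ne]
  rcases fourExit_fourCost_cases hd.1 hd.2.1 hd.2.2 with
    ⟨m, hm, hmk, hX, hC⟩ | ⟨m, hm, rfl, hX, hC⟩ | ⟨m, hm, hX, hC⟩ <;> rw [hX, hC]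
  · have h : k * (m + 2) ≤ k * k := Nat.mul_le_mul_left k (by omega)
    have h' : k * (m + 2) = k * m + 2 * k := by ring
    omega
  · have h : (m + 1) * (m + 1) = (m + 1) * m + (m + 1) := by ring
    omega
  · have h : k * (m + 1) ≤ k * k := Nat.mul_le_mul_left k (by omega)
    have h' : k * (m + 1) = k * m + k := by ring
    omega

/-- The farthest pair is at position 0 of the last orbit `4 k`, whose exit is at its other end. -/
theorem exists_potential_four_eq {k : ℕ} (hk : 2 ≤ k) :
    ∃ p q, 1 ≤ p ∧ p < q ∧ q ≤ 4 * k ∧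
      potential (fourExit k) (fourCost k) (4 * k) p q = 4 * (k * k) + 2 * k - 1 := by
  obtain ⟨m, rfl⟩ : ∃ m, k = m + 1 := ⟨k - 1, by omega⟩
  have h := orbitIndex_of_odd_add_le (n := 4 * (m + 1)) (p := 2 * (m + 1)) (q := 2 * (m + 1) + 1)
    (by omega) (by omega)
  obtain ⟨hX, hC⟩ := fourExit_fourCost_top (m := m)
  refine ⟨2 * (m + 1), 2 * (m + 1) + 1, by omega, by omega, by omega, ?_⟩
  rw [potential_eq (by omega) (h.1.trans (by omega)) h.2 hX hC]
  have h : (m + 1) * (m + 1) = (m + 1) * m + (m + 1) := by ring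
  omega

theorem autA_four_squareDiam_and_sync {n k : ℕ} (hk : 2 ≤ k) (hn : n = 4 * k) {i j : State n}
    (hi : (i : ℕ) = 1) (hj : (j : ℕ) = n - 2) :
    HasSquareDiam (autA n i j) (((n : ℚ) ^ 2 + 2 * n - 4) / 4) ∧
      SyncWithThresholdGE (autA n i j) ((n : ℚ) ^ 2 / 4) := by
  subst hn
  have hM : ((4 * (k * k) + 2 * k - 1 : ℕ) : ℚ) = 4 * (k * k) + 2 * k - 1 := by
    rw [Nat.cast_sub (by omega)]
    push_cast
    ring
  refine autA_squareDiam_and_sync (X := fourExit k) (C := fourCost k)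
    (fun p q hp hpq hq => fourExit_lt hp hpq hq) ?_ ?_
    (fun p q hp hpq hq => potential_four_le hk hp hpq hq) (exists_potential_four_eq hk) ?_ ?_
  · intro p q hp hpq hq hX
    rw [hi]
    exact eq_of_orbitPos_eq_fourExit hp hpq hq hX
  · intro q hq hqn hqi
    rw [hi, hj]
    rcases Nat.mod_two_eq_zero_or_one q with hq2 | hq2
    · exact potential_four_pert_of_even hk hq hqn (hi ▸ hqi) hq2
    · exact potential_four_pert_of_odd hk hq hqn (hi ▸ hqi) hq2
  · rw [hM]
    push_cast
    ring
  · rw [hM]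
    have : (2 : ℚ) ≤ k := by exact_mod_cast hk
    push_cast
    nlinarith

/-! ### The family `n = 4 k + 2`, `i = 1`, `j = 4 k - 2` -/

/-- The position on the orbit with index `d` at which a shortest merging path leaves it,
for `𝒜_{1, 4 k - 2}` on `4 k + 2` states. -/
def sixExit (k d : ℕ) : ℕ :=
  if d % 8 = 0 then d / 2 else if d % 4 = 0 then d / 2 - 1
  else if (d + 4 * k) % 8 = 6 then d / 2 - 1 else min (d / 2) (2 * k)

/-- The distance from the exit position of the orbit with index `d` to the singletons,
for `𝒜_{1, 4 k - 2}` on `4 k + 2` states. -/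
def sixCost (k d : ℕ) : ℕ :=
  if d % 8 = 0 then 4 * (k * (d / 8 - 1)) + d + min 3 (4 * k - d)
  else if d % 4 = 0 then 4 * (k * (k - 1 - d / 8)) + 4 * k
  else if (d + 4 * k) % 8 = 6 then 4 * (k * ((4 * k - 2 - d) / 8)) + 1
  else 4 * (k * ((d + 4 * k - 2) / 8)) + d + min 5 (4 * k + 2 - d) - 3

theorem sixExit_sixCost_eight_mul {k s d : ℕ} (hs : d = 8 * s + 8) :
    sixExit k d = 4 * s + 4 ∧
      sixCost k d = 4 * (k * s) + 8 * s + 8 + min 3 (4 * k - (8 * s + 8)) := by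
  subst hs
  have h1 : (8 * s + 8) % 8 = 0 := by omega
  have h2 : (8 * s + 8) / 8 - 1 = s := by omega
  simp only [sixExit, sixCost, h1, h2, if_true]
  omega

theorem sixExit_sixCost_four_mul {k s d : ℕ} (hs : d + 8 * s + 4 = 8 * k) :
    sixExit k d = 4 * k - 3 - 4 * s ∧ sixCost k d = 4 * (k * s) + 4 * k := by
  have h1 : d % 8 ≠ 0 := by omega
  have h2 : d % 4 = 0 := by omega
  have h3 : k - 1 - d / 8 = s := by omega
  simp only [sixExit, sixCost, if_neg h1, if_pos h2, h3, and_true]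
  omega

theorem sixExit_sixCost_sub {k s d : ℕ} (hs : d + 8 * s + 2 = 4 * k) :
    sixExit k d = 2 * k - 2 - 4 * s ∧ sixCost k d = 4 * (k * s) + 1 := by
  have h1 : d % 8 ≠ 0 := by omega
  have h2 : d % 4 ≠ 0 := by omega
  have h3 : (4 * k - 2 - d) / 8 = s := by omega
  have h4 : (d + 4 * k) % 8 = 6 := by omega
  simp only [sixExit, sixCost, if_neg h1, if_neg h2, if_pos h4, h3, and_true]
  omega

theorem sixExit_sixCost_add {k s d : ℕ} (hs : d + 4 * k = 8 * s + 2) :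
    sixExit k d = min (4 * s + 1 - 2 * k) (2 * k) ∧
      sixCost k d = 4 * (k * s) + d + min 5 (4 * k + 2 - d) - 3 := by
  have h1 : d % 8 ≠ 0 := by omega
  have h2 : d % 4 ≠ 0 := by omega
  have h3 : (d + 4 * k - 2) / 8 = s := by omega
  have h4 : (d + 4 * k) % 8 ≠ 6 := by omega
  simp only [sixExit, sixCost, if_neg h1, if_neg h2, if_neg h4, h3, and_true]
  omega

/-- The four classes modulo 8 that make up the chain. The third, from `4 k - 2` down, alternates
with the first, from 8 up; after the turn the second, going down to 4, alternates with the fourth,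
going up to `4 k + 2`. In each class `s` measures progress along the chain. -/
theorem six_orbit_cases {k d : ℕ} (hd : d % 2 = 0) (hd2 : 2 ≤ d) (hdk : d ≤ 4 * k + 2) :
    (∃ s, d = 8 * s + 8) ∨ (∃ s, d + 8 * s + 4 = 8 * k) ∨ (∃ s, d + 8 * s + 2 = 4 * k) ∨
      (∃ s, d + 4 * k = 8 * s + 2) := by
  by_cases h1 : d % 8 = 0
  · exact Or.inl ⟨d / 8 - 1, by omega⟩
  by_cases h2 : d % 4 = 0
  · exact Or.inr (Or.inl ⟨k - 1 - d / 8, by omega⟩)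
  by_cases h3 : (d + 4 * k) % 8 = 6
  · by_cases h4 : d + 2 ≤ 4 * k
    · exact Or.inr (Or.inr (Or.inl ⟨(4 * k - 2 - d) / 8, by omega⟩))
    · omega
  · exact Or.inr (Or.inr (Or.inr ⟨(d + 4 * k - 2) / 8, by omega⟩))

theorem sixExit_lt {k p q : ℕ} (hp : 1 ≤ p) (hpq : p < q) (hq : q ≤ 4 * k + 2) :
    sixExit k (orbitIndex (4 * k + 2) p q) < 4 * k + 2 ∧
      (orbitIndex (4 * k + 2) p q = 4 * k + 2 →
        sixExit k (orbitIndex (4 * k + 2) p q) < (4 * k + 2) / 2) := by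
  have hd : orbitIndex (4 * k + 2) p q ≤ 4 * k + 2 := by
    rcases orbit_cases (n := 4 * k + 2) hp (by omega) (by omega) hq hpq.ne with
      ⟨c, hO⟩ | ⟨c, hO⟩ | ⟨c, hO⟩ <;> omega
  unfold sixExit
  split_ifs <;> omega

theorem eq_of_orbitPos_eq_sixExit {k p q : ℕ} (hp : 1 ≤ p) (hpq : p < q)
    (hq : q ≤ 4 * k + 2)
    (hX : orbitPos (4 * k + 2) p q = sixExit k (orbitIndex (4 * k + 2) p q)) :
    p = 1 ∨ q = 1 := by
  have hX' : sixExit k (orbitIndex (4 * k + 2) p q) = orbitIndex (4 * k + 2) p q / 2 ∨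
      sixExit k (orbitIndex (4 * k + 2) p q) = orbitIndex (4 * k + 2) p q / 2 - 1 ∨
      sixExit k (orbitIndex (4 * k + 2) p q) = 2 * k ∧
        2 * k ≤ orbitIndex (4 * k + 2) p q / 2 := by
    unfold sixExit
    split_ifs <;> omega
  have hX2 : orbitIndex (4 * k + 2) p q = 4 * k + 2 →
      sixExit k (orbitIndex (4 * k + 2) p q) = 2 * k := by
    intro h
    rw [h]
    unfold sixExit
    split_ifs <;> omega
  rw [← hX] at hX' hX2
  rcases orbit_cases (n := 4 * k + 2) hp (by omega) (by omega) hq hpq.ne with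
    ⟨c, hO⟩ | ⟨c, hO⟩ | ⟨c, hO⟩ <;> omega

/-- The inequalities which the potential for `𝒜_{1, 4 k - 2}` on `4 k + 2` states has to satisfy
along the edge from `{1, q}` to `{4 k - 2, q}`. -/
def SixStep (k q : ℕ) : Prop :=
  potential (sixExit k) (sixCost k) (4 * k + 2) 1 q ≤
      potential (sixExit k) (sixCost k) (4 * k + 2) (4 * k - 2) q + 1 ∧
    (orbitPos (4 * k + 2) 1 q = sixExit k (orbitIndex (4 * k + 2) 1 q) →
      potential (sixExit k) (sixCost k) (4 * k + 2) (4 * k - 2) q <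
        potential (sixExit k) (sixCost k) (4 * k + 2) 1 q)

theorem sixStep_of_eq {k q d y x c d' y' x' c' : ℕ} (hq : q ≠ 1) (hqj : 4 * k - 2 ≠ q)
    (hi : orbitIndex (4 * k + 2) 1 q = d ∧ orbitPos (4 * k + 2) 1 q = y)
    (hX : sixExit k d = x ∧ sixCost k d = c)
    (hj : orbitIndex (4 * k + 2) (4 * k - 2) q = d' ∧
      orbitPos (4 * k + 2) (4 * k - 2) q = y')
    (hX' : sixExit k d' = x' ∧ sixCost k d' = c')
    (h : (y - x) + (x - y) + c ≤ (y' - x') + (x' - y') + c' + 1)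
    (h' : y = x → (y' - x') + (x' - y') + c' < c) : SixStep k q := by
  unfold SixStep
  rw [potential_eq hq.symm hi.1 hi.2 hX.1 hX.2, potential_eq hqj hj.1 hj.2 hX'.1 hX'.2,
    hi.1, hi.2, hX.1]
  refine ⟨h, fun hy => ?_⟩
  have := h' hy
  omega

theorem orbitIndex_one_of_even {n q : ℕ} (hq : q % 2 = 0) (h : 1 ≤ q) (hqn : q ≤ n) :
    orbitIndex n 1 q = q ∧ orbitPos n 1 q = q / 2 - 1 := by
  have h1 := orbitIndex_of_odd_add_le (n := n) (p := 1) (q := q) (by omega) (by omega)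
  omega

theorem orbitIndex_one_of_odd {n q : ℕ} (hq : q % 2 = 1) :
    orbitIndex n 1 q = q - 1 ∧ orbitPos n 1 q = q / 2 := by
  have h1 := orbitIndex_of_even_add (n := n) (p := 1) (q := q) (by omega)
  omega

theorem orbitIndex_six_of_even {k q : ℕ} (hk : 1 ≤ k) (hq : q % 2 = 0) :
    orbitIndex (4 * k + 2) (4 * k - 2) q = (4 * k - 2 - q) + (q - (4 * k - 2)) ∧
      orbitPos (4 * k + 2) (4 * k - 2) q = 2 * k - 2 + q / 2 := by
  have h1 := orbitIndex_of_even_add (n := 4 * k + 2) (p := 4 * k - 2) (q := q) (by omega)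
  omega

theorem orbitIndex_six_of_odd_le {k q : ℕ} (hk : 2 ≤ k) (hq : q % 2 = 1) (hq5 : q ≤ 5) :
    orbitIndex (4 * k + 2) (4 * k - 2) q = 4 * k - 3 + q ∧
      orbitPos (4 * k + 2) (4 * k - 2) q = 2 * k - 2 - q / 2 := by
  have h1 := orbitIndex_of_odd_add_le (n := 4 * k + 2) (p := 4 * k - 2) (q := q) (by omega)
    (by omega)
  omega

theorem orbitIndex_six_of_odd_gt {k q : ℕ} (hq : q % 2 = 1) (hq5 : 5 < q)
    (hqn : q ≤ 4 * k + 1) :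
    orbitIndex (4 * k + 2) (4 * k - 2) q = 4 * k + 7 - q ∧
      orbitPos (4 * k + 2) (4 * k - 2) q = min (2 * k + 3 + q / 2) (6 * k - q / 2) := by
  have h1 := orbitIndex_of_odd_add_gt (n := 4 * k + 2) (p := 4 * k - 2) (q := q) (by omega)
    (by omega)
  omega

/-! ### Comparison of `{1, q}` with `{4 k - 2, q}`, class by class -/

theorem sixStep_even_eight_mul {k s q : ℕ} (hk : 2 ≤ k) (hqn : q ≤ 4 * k + 2)
    (hs : q = 8 * s + 8) (h : 2 * s + 2 < k) :
    SixStep k q := by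
  have hr : k * (s + 1) = k * s + k := by ring
  refine sixStep_of_eq (by omega) (by omega) (orbitIndex_one_of_even (by omega) (by omega) (by omega))
    (sixExit_sixCost_eight_mul (s := s) (by omega))
    (orbitIndex_six_of_even (by omega) (by omega))
    (sixExit_sixCost_sub (s := s + 1) (by omega)) ?_ ?_ <;> omega

theorem sixStep_even_eight_mul_eq {k s q : ℕ} (hk : 2 ≤ k) (hqn : q ≤ 4 * k + 2)
    (hs : q = 8 * s + 8) (h : 2 * s + 2 = k) :
    SixStep k q := by
  have hr : k * (s + 1) = k * s + k := by ring
  refine sixStep_of_eq (by omega) (by omega) (orbitIndex_one_of_even (by omega) (by omega) (by omega))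
    (sixExit_sixCost_eight_mul (s := s) (by omega))
    (orbitIndex_six_of_even (by omega) (by omega))
    (sixExit_sixCost_add (s := s + 1) (by omega)) ?_ ?_ <;> omega

theorem sixStep_even_four_mul {k s q : ℕ} (hk : 2 ≤ k) (hqn : q ≤ 4 * k + 2)
    (hs : q + 8 * s + 4 = 8 * k) (h : k ≤ 2 * s) :
    SixStep k q := by
  refine sixStep_of_eq (by omega) (by omega) (orbitIndex_one_of_even (by omega) (by omega) (by omega))
    (sixExit_sixCost_four_mul (s := s) (by omega))
    (orbitIndex_six_of_even (by omega) (by omega))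
    (sixExit_sixCost_add (s := s) (by omega)) ?_ ?_ <;> omega

/-- The turn of the chain for odd `k`: the orbit `4 k` exits through `{1, 4 k}` into the orbit 2. -/
theorem sixStep_even_four_mul_eq {k s q : ℕ} (hk : 2 ≤ k) (hqn : q ≤ 4 * k + 2)
    (hs : q + 8 * s + 4 = 8 * k) (h : k = 2 * s + 1) :
    SixStep k q := by
  refine sixStep_of_eq (by omega) (by omega) (orbitIndex_one_of_even (by omega) (by omega) (by omega))
    (sixExit_sixCost_four_mul (s := s) (by omega))
    (orbitIndex_six_of_even (by omega) (by omega))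
    (sixExit_sixCost_sub (s := s) (by omega)) ?_ ?_ <;> omega

theorem sixStep_even_sub {k s q : ℕ} (hk : 2 ≤ k) (hqn : q ≤ 4 * k + 2)
    (hs : q + 8 * (s + 1) + 2 = 4 * k) :
    SixStep k q := by
  have hr : k * (s + 1) = k * s + k := by ring
  refine sixStep_of_eq (by omega) (by omega) (orbitIndex_one_of_even (by omega) (by omega) (by omega))
    (sixExit_sixCost_sub (s := s + 1) (by omega))
    (orbitIndex_six_of_even (by omega) (by omega))
    (sixExit_sixCost_eight_mul (s := s) (by omega)) ?_ ?_ <;> omega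

/-- The start of the chain: the third letter merges `{1, 4 k - 2}`. -/
theorem sixStep_even_self {k : ℕ} (hk : 2 ≤ k) : SixStep k (4 * k - 2) := by
  have h0 : potential (sixExit k) (sixCost k) (4 * k + 2) (4 * k - 2) (4 * k - 2) = 0 :=
    if_pos rfl
  obtain ⟨hd, hy⟩ := orbitIndex_one_of_even (n := 4 * k + 2) (q := 4 * k - 2) (by omega)
    (by omega) (by omega)
  obtain ⟨hX, hC⟩ := sixExit_sixCost_sub (k := k) (s := 0) (d := 4 * k - 2) (by omega)
  unfold SixStep
  rw [h0, potential_eq (by omega) hd hy hX hC, hd, hy, hX]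
  omega

theorem sixStep_even_add {k s q : ℕ} (hk : 2 ≤ k) (hqn : q ≤ 4 * k + 2)
    (hs : q + 4 * k = 8 * s + 2) (h : s < k) :
    SixStep k q := by
  refine sixStep_of_eq (by omega) (by omega) (orbitIndex_one_of_even (by omega) (by omega) (by omega))
    (sixExit_sixCost_add (s := s) (by omega))
    (orbitIndex_six_of_even (by omega) (by omega))
    (sixExit_sixCost_four_mul (s := s) (by omega)) ?_ ?_ <;> omega

theorem sixStep_even_top {k s q : ℕ} (hk : 2 ≤ k)
    (hs : q = 4 * k + 2) (h : s + 1 = k) :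
    SixStep k q := by
  have hr : k * (s + 1) = k * s + k := by ring
  refine sixStep_of_eq (by omega) (by omega) (orbitIndex_one_of_even (by omega) (by omega) (by omega))
    (sixExit_sixCost_add (s := s + 1) (by omega))
    (orbitIndex_six_of_even (by omega) (by omega))
    (sixExit_sixCost_four_mul (s := s) (by omega)) ?_ ?_ <;> omega

theorem sixStep_odd_eight_mul {k s q : ℕ} (hk : 2 ≤ k) (hqn : q ≤ 4 * k + 2)
    (hs : q = 8 * s + 9) :
    SixStep k q := by
  refine sixStep_of_eq (by omega) (by omega) (orbitIndex_one_of_odd (by omega))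
    (sixExit_sixCost_eight_mul (s := s) (by omega))
    (orbitIndex_six_of_odd_gt (by omega) (by omega) (by omega))
    (sixExit_sixCost_sub (s := s) (by omega)) ?_ ?_ <;> omega

theorem sixStep_odd_four_mul {k s q : ℕ} (hk : 2 ≤ k) (hqn : q ≤ 4 * k + 2)
    (hs : q + 8 * s + 3 = 8 * k) (h : s + 1 < k) :
    SixStep k q := by
  have hr : k * (s + 1) = k * s + k := by ring
  refine sixStep_of_eq (by omega) (by omega) (orbitIndex_one_of_odd (by omega))
    (sixExit_sixCost_four_mul (s := s) (by omega))
    (orbitIndex_six_of_odd_gt (by omega) (by omega) (by omega))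
    (sixExit_sixCost_add (s := s + 1) (by omega)) ?_ ?_ <;> omega

theorem sixStep_odd_four_mul_top {k s q : ℕ} (hk : 2 ≤ k)
    (hs : q = 5) (h : s + 1 = k) :
    SixStep k q := by
  have hr : k * (s + 1) = k * s + k := by ring
  refine sixStep_of_eq (by omega) (by omega) (orbitIndex_one_of_odd (by omega))
    (sixExit_sixCost_four_mul (s := s) (by omega))
    (orbitIndex_six_of_odd_le (by omega) (by omega) (by omega))
    (sixExit_sixCost_add (s := s + 1) (by omega)) ?_ ?_ <;> omega

theorem sixStep_odd_sub {k s q : ℕ} (hk : 2 ≤ k) (hqn : q ≤ 4 * k + 2)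
    (hs : q + 8 * s + 1 = 4 * k) (hq : 3 < q) :
    SixStep k q := by
  refine sixStep_of_eq (by omega) (by omega) (orbitIndex_one_of_odd (by omega))
    (sixExit_sixCost_sub (s := s) (by omega))
    (orbitIndex_six_of_odd_gt (by omega) (by omega) (by omega))
    (sixExit_sixCost_eight_mul (s := s) (by omega)) ?_ ?_ <;> omega

theorem sixStep_odd_sub_eq {k s q : ℕ} (hk : 2 ≤ k)
    (hs : q = 3) (h : 2 * s + 1 = k) :
    SixStep k q := by
  refine sixStep_of_eq (by omega) (by omega) (orbitIndex_one_of_odd (by omega))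
    (sixExit_sixCost_sub (s := s) (by omega))
    (orbitIndex_six_of_odd_le (by omega) (by omega) (by omega))
    (sixExit_sixCost_four_mul (s := s) (by omega)) ?_ ?_ <;> omega

theorem sixStep_odd_add {k s q : ℕ} (hk : 2 ≤ k) (hqn : q ≤ 4 * k + 2)
    (hs : q + 4 * k = 8 * (s + 1) + 3) (hq : 3 < q) :
    SixStep k q := by
  have hr : k * (s + 1) = k * s + k := by ring
  refine sixStep_of_eq (by omega) (by omega) (orbitIndex_one_of_odd (by omega))
    (sixExit_sixCost_add (s := s + 1) (by omega))
    (orbitIndex_six_of_odd_gt (by omega) (by omega) (by omega))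
    (sixExit_sixCost_four_mul (s := s) (by omega)) ?_ ?_ <;> omega

/-- The turn of the chain for even `k`: the orbit 2 exits through `{1, 3}` into the orbit `4 k`. -/
theorem sixStep_odd_add_eq {k s q : ℕ} (hk : 2 ≤ k)
    (hs : q = 3) (h : 2 * (s + 1) = k) :
    SixStep k q := by
  have hr : k * (s + 1) = k * s + k := by ring
  refine sixStep_of_eq (by omega) (by omega) (orbitIndex_one_of_odd (by omega))
    (sixExit_sixCost_add (s := s + 1) (by omega))
    (orbitIndex_six_of_odd_le (by omega) (by omega) (by omega))
    (sixExit_sixCost_eight_mul (s := s) (by omega)) ?_ ?_ <;> omega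

theorem sixStep_of_even {k q : ℕ} (hk : 2 ≤ k) (hq : 1 ≤ q) (hqn : q ≤ 4 * k + 2)
    (hq2 : q % 2 = 0) : SixStep k q := by
  rcases six_orbit_cases hq2 (by omega) hqn with ⟨s, hs⟩ | ⟨s, hs⟩ | ⟨s, hs⟩ | ⟨s, hs⟩
  · by_cases h : 2 * s + 2 < k
    · exact sixStep_even_eight_mul hk hqn hs h
    · exact sixStep_even_eight_mul_eq hk hqn hs (by omega)
  · by_cases h : k ≤ 2 * s
    · exact sixStep_even_four_mul hk hqn hs h
    · exact sixStep_even_four_mul_eq hk hqn hs (by omega)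
  · rcases s with _ | s
    · obtain rfl : q = 4 * k - 2 := by omega
      exact sixStep_even_self hk
    · exact sixStep_even_sub hk hqn hs
  · by_cases h : s < k
    · exact sixStep_even_add hk hqn hs h
    · exact sixStep_even_top (s := k - 1) hk (by omega) (by omega)

theorem sixStep_of_odd {k q : ℕ} (hk : 2 ≤ k) (hq : 2 ≤ q) (hqn : q ≤ 4 * k + 2)
    (hq2 : q % 2 = 1) : SixStep k q := by
  rcases six_orbit_cases (k := k) (d := q - 1) (by omega) (by omega) (by omega) with
    ⟨s, hs⟩ | ⟨s, hs⟩ | ⟨s, hs⟩ | ⟨s, hs⟩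
  · exact sixStep_odd_eight_mul hk hqn (s := s) (by omega)
  · by_cases h : s + 1 < k
    · exact sixStep_odd_four_mul hk hqn (s := s) (by omega) h
    · exact sixStep_odd_four_mul_top (s := s) hk (by omega) (by omega)
  · by_cases h : 3 < q
    · exact sixStep_odd_sub hk hqn (s := s) (by omega) h
    · exact sixStep_odd_sub_eq (s := s) hk (by omega) (by omega)
  · obtain ⟨s, rfl⟩ : ∃ t, s = t + 1 := ⟨s - 1, by omega⟩
    by_cases h : 3 < q
    · exact sixStep_odd_add hk hqn (s := s) (by omega) h
    · exact sixStep_odd_add_eq (s := s) hk (by omega) (by omega)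

theorem potential_six_le {k p q : ℕ} (hk : 2 ≤ k) (hp : 1 ≤ p) (hpq : p < q)
    (hq : q ≤ 4 * k + 2) :
    potential (sixExit k) (sixCost k) (4 * k + 2) p q ≤ 4 * (k * k) + 6 * k - 1 := by
  have hO := orbit_cases (n := 4 * k + 2) hp (by omega) (by omega) hq hpq.ne
  have hd : orbitIndex (4 * k + 2) p q % 2 = 0 ∧ 2 ≤ orbitIndex (4 * k + 2) p q ∧
      orbitIndex (4 * k + 2) p q ≤ 4 * k + 2 := by
    rcases hO with ⟨c, hO⟩ | ⟨c, hO⟩ | ⟨c, hO⟩ <;> omega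
  have hy : orbitPos (4 * k + 2) p q < 4 * k + 2 ∧
      (orbitIndex (4 * k + 2) p q = 4 * k + 2 → orbitPos (4 * k + 2) p q < 2 * k + 1) := by
    rcases hO with ⟨c, hO⟩ | ⟨c, hO⟩ | ⟨c, hO⟩ <;> omega
  clear hO
  rw [potential, if_neg hpq.ne]
  generalize orbitIndex (4 * k + 2) p q = d at *
  generalize orbitPos (4 * k + 2) p q = y at *
  have hkk : k * 2 ≤ k * k := Nat.mul_le_mul_left k hk
  rcases six_orbit_cases hd.1 hd.2.1 hd.2.2 with ⟨s, hs⟩ | ⟨s, hs⟩ | ⟨s, hs⟩ | ⟨s, hs⟩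
  · obtain ⟨hX, hC⟩ := sixExit_sixCost_eight_mul (k := k) hs
    rw [hX, hC]
    have h : k * (2 * s + 2) ≤ k * k := Nat.mul_le_mul_left k (by omega)
    have h' : k * (2 * s + 2) = 2 * (k * s) + 2 * k := by ring
    omega
  · obtain ⟨hX, hC⟩ := sixExit_sixCost_four_mul hs
    rw [hX, hC]
    have h : k * (s + 1) ≤ k * k := Nat.mul_le_mul_left k (by omega)
    have h' : k * (s + 1) = k * s + k := by ring
    omega
  · obtain ⟨hX, hC⟩ := sixExit_sixCost_sub hs
    rw [hX, hC]
    have h : k * (2 * s + 1) ≤ k * k := Nat.mul_le_mul_left k (by omega)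
    have h' : k * (2 * s + 1) = 2 * (k * s) + k := by ring
    omega
  · obtain ⟨hX, hC⟩ := sixExit_sixCost_add hs
    rw [hX, hC]
    -- `s = k` means `d = 4 k + 2`, the last orbit, which has only `2 k + 1` positions.
    by_cases hsk : s = k
    · subst hsk
      omega
    · have h : k * (s + 1) ≤ k * k := Nat.mul_le_mul_left k (by omega)
      have h' : k * (s + 1) = k * s + k := by ring
      omega

theorem exists_potential_six_eq {k : ℕ} (hk : 2 ≤ k) :
    ∃ p q, 1 ≤ p ∧ p < q ∧ q ≤ 4 * k + 2 ∧
      potential (sixExit k) (sixCost k) (4 * k + 2) p q = 4 * (k * k) + 6 * k - 1 := by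
  have h := orbitIndex_of_odd_add_le (n := 4 * k + 2) (p := 2 * k + 1) (q := 2 * k + 2)
    (by omega) (by omega)
  obtain ⟨hX, hC⟩ := sixExit_sixCost_add (k := k) (s := k) (d := 4 * k + 2) (by omega)
  refine ⟨2 * k + 1, 2 * k + 2, by omega, by omega, by omega, ?_⟩
  rw [potential_eq (by omega) (h.1.trans (by omega)) h.2 hX hC]
  omega

theorem autA_six_squareDiam_and_sync {n k : ℕ} (hk : 2 ≤ k) (hn : n = 4 * k + 2)
    {i j : State n} (hi : (i : ℕ) = 1) (hj : (j : ℕ) = n - 4) :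
    HasSquareDiam (autA n i j) (((n : ℚ) ^ 2 + 2 * n - 12) / 4) ∧
      SyncWithThresholdGE (autA n i j) ((n : ℚ) ^ 2 / 4) := by
  subst hn
  have hj' : (j : ℕ) = 4 * k - 2 := by omega
  have hM : ((4 * (k * k) + 6 * k - 1 : ℕ) : ℚ) = 4 * (k * k) + 6 * k - 1 := by
    rw [Nat.cast_sub (by omega)]
    push_cast
    ring
  refine autA_squareDiam_and_sync (X := sixExit k) (C := sixCost k)
    (fun p q hp hpq hq => sixExit_lt hp hpq hq) ?_ ?_
    (fun p q hp hpq hq => potential_six_le hk hp hpq hq) (exists_potential_six_eq hk) ?_ ?_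
  · intro p q hp hpq hq hX
    rw [hi]
    exact eq_of_orbitPos_eq_sixExit hp hpq hq hX
  · intro q hq hqn hqi
    rw [hi, hj']
    have hq1 : q ≠ 1 := hi ▸ hqi
    rcases Nat.mod_two_eq_zero_or_one q with hq2 | hq2
    · exact sixStep_of_even hk hq hqn hq2
    · exact sixStep_of_odd hk (by omega) hqn hq2
  · rw [hM]
    push_cast
    ring
  · rw [hM]
    have : (2 : ℚ) ≤ k := by exact_mod_cast hk
    push_cast
    nlinarith

end SlowSync

/-! ### The four families together -/

theorem theorem3 :
    (∀ (n : ℕ) (h : 8 ≤ n ∧ n % 4 = 0),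
      SlowSync.HasSquareDiam (SlowSync.autE n h) (((n : ℚ) ^ 2 + 2 * n - 4) / 4) ∧
      SlowSync.SyncWithThresholdGE (SlowSync.autE n h) ((n : ℚ) ^ 2 / 4)) ∧
    (∀ (n : ℕ) (h : 10 ≤ n ∧ n % 4 = 2),
      SlowSync.HasSquareDiam (SlowSync.autE' n h) (((n : ℚ) ^ 2 + 2 * n - 12) / 4) ∧
      SlowSync.SyncWithThresholdGE (SlowSync.autE' n h) ((n : ℚ) ^ 2 / 4)) ∧
    (∀ (n : ℕ) (h : 5 ≤ n ∧ n % 4 = 1),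
      SlowSync.HasSquareDiam (SlowSync.autO n h) (((n : ℚ) ^ 2 + 3 * n - 8) / 4) ∧
      SlowSync.SyncWithThresholdGE (SlowSync.autO n h) ((n : ℚ) ^ 2 / 4)) ∧
    (∀ (n : ℕ) (h : 7 ≤ n ∧ n % 4 = 3),
      SlowSync.HasSquareDiam (SlowSync.autO' n h) (((n : ℚ) ^ 2 + 3 * n - 6) / 4) ∧
      SlowSync.SyncWithThresholdGE (SlowSync.autO' n h) ((n : ℚ) ^ 2 / 4)) := by
  refine ⟨fun n h => ?_, fun n h => ?_, fun n h => ?_, fun n h => ?_⟩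
  · exact SlowSync.autA_four_squareDiam_and_sync (k := n / 4) (by omega) (by omega) rfl rfl
  · exact SlowSync.autA_six_squareDiam_and_sync (k := n / 4) (by omega) (by omega) rfl rfl
  · obtain ⟨k, hk⟩ : ∃ k, n = 4 * (k + 1) + 1 := ⟨n / 4 - 1, by omega⟩
    have key := SlowSync.autA_odd_squareDiam_and_sync (n := n) (h := 2 * (k + 1)) (by omega)
      (by omega) (i := ⟨(n - 1) / 2, Finset.mem_Icc.2 (by omega)⟩)
      (j := ⟨(n + 1) / 2, Finset.mem_Icc.2 (by omega)⟩) (by simp only; omega) (by simp only; omega)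
    have hd : (5 * (2 * (k + 1)) - 1) / 2 = 5 * k + 4 := by omega
    rw [hd] at key
    have hM : ((n : ℚ) ^ 2 + 3 * n - 8) / 4 =
        ((2 * (k + 1) * (2 * (k + 1)) + (5 * k + 4) : ℕ) : ℚ) := by
      rw [hk]
      push_cast
      ring
    rw [hM]
    exact key
  · obtain ⟨k, hk⟩ : ∃ k, n = 4 * k + 3 := ⟨n / 4, by omega⟩
    have key := SlowSync.autA_odd_squareDiam_and_sync (n := n) (h := 2 * k + 1) (by omega)
      (by omega) (i := ⟨(n - 1) / 2, Finset.mem_Icc.2 (by omega)⟩)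
      (j := ⟨(n + 1) / 2, Finset.mem_Icc.2 (by omega)⟩) (by simp only; omega) (by simp only; omega)
    have hd : (5 * (2 * k + 1) - 1) / 2 = 5 * k + 2 := by omega
    rw [hd] at key
    have hM : ((n : ℚ) ^ 2 + 3 * n - 6) / 4 = (((2 * k + 1) * (2 * k + 1) + (5 * k + 2) : ℕ) : ℚ) := by
      rw [hk]
      push_cast
      ring
    rw [hM]
    exact key
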